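/- **Language.** Patterns are $p,q ::= \alpha \mid \mathsf{leaf} \mid \mathsf{node}(p,q) \mid \_ \mid \bot$ ($\alpha$ a pattern variable, $\_$ the wildcard). Types are $T,U ::= B(p) \mid T\to U \mid \forall\alpha.T$. Terms are $t,u ::= x \mid f \mid t\,u \mid t\,p \mid \lambda x{:}T.t \mid \Lambda\alpha.t \mid \mathrm{Node} \mid \mathrm{Leaf}$, with $f$ in a set $\Sigma$ of function symbols. Each $f\in\Sigma$ has a closed type $\tau_f=\forall\alpha_1\dots\alpha_n.\,B(\alpha_1)\to\dots\to B(\alpha_k)\to T_f$ with $k\le n$ and no negative occurrence of $\alpha_1,\dots,\alpha_k$ in $T_f$; $k=k_f$ is the number of recursive arguments of $f$ and $n=n_f$ its number of pattern arguments. The order $\ll$ on patterns is given by $p\ll\_$, $\bot\ll p$, $\alpha\ll\alpha$, $\mathsf{leaf}\ll\mathsf{leaf}$, and $\mathsf{node}(p_1,p_2)\ll\mathsf{node}(q_1,q_2)$ if $p_i\ll q_i$ for $i=1,2$; subtyping is given by $B(p)\le B(q)$ if $p\ll q$, contravariantly/covariantly on arrows, and $\forall\alpha.T\le\forall\alpha.U$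 if $T\le U$. The judgement $\Gamma\vdash t:T$ is generated by the usual rules for variables, $\lambda$-abstraction and application, pattern abstraction ($\Gamma\vdash\Lambda\alpha.t:\forall\alpha.T$ if $\Gamma\vdash t:T$ and $\alpha$ is not free in $\Gamma$), pattern application ($\Gamma\vdash t\,p:T[\alpha:=p]$ if $\Gamma\vdash t:\forall\alpha.T$), subsumption, and $\mathrm{Leaf}:B(\mathsf{leaf})$, $\mathrm{Node}:\forall\alpha\beta.B(\alpha)\to B(\beta)\to B(\mathsf{node}(\alpha,\beta))$, $f:\tau_f$. **Rules.** A rewrite rule is $f\,p_1\dots p_n\,l_1\dots l_k\to r$ with $n=n_f$, $k=k_f$, where the $l_i$ are constructor terms $l::=x\mid\mathrm{Leaf}\mid\mathrm{Node}\,p\,p'\,l\,l'$, the free term variables of $r$ occur in the left-hand side, and every symbol $g$ in $r$ is applied to its $n_g$ pattern arguments. Minimal typing of constructor terms is: $\Gamma\vdash_{\min}x:B(\alpha)$ if $\Gamma(x)=B(\alpha)$ and $\alpha$ is not free in the type of any other variable of $\Gamma$; $\Gamma\vdash_{\min}\mathrm{Leaf}:B(\mathsf{leaf})$; $\Gamma\vdash_{\min}\mathrm{Node}\,p\,p'\,l\,l':B(\mathsf{node}(p,p'))$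 if $\Gamma\vdash_{\min}l:B(p)$ and $\Gamma\vdash_{\min}l':B(p')$. For left-hand sides, $\Gamma\vdash_{\min}f\,p_1\dots p_k\,\beta_{k+1}\dots\beta_n\,l_1\dots l_k:T_f[\alpha_i:=p_i,\ \alpha_j:=\beta_j]$ (for $i\le k<j$) if $\Gamma\vdash_{\min}l_i:B(p_i)$ for all $i\le k$ and the $\beta_j$ are distinct pattern variables not free in $\Gamma$. A rule $l\to r$ is well-typed if $\Gamma\vdash_{\min}l:T$ and $\Gamma\vdash r:T$ for some $\Gamma$ and $T$. **Dependency graph.** Let $\mathcal R$ be a finite set of well-typed rules. Its dependency pairs are the $f^\sharp(p_1,\dots,p_{k_f})\to g^\sharp(q_1,\dots,q_{k_g})$ for each rule $f\,\vec p\,\vec l\to r$ in $\mathcal R$ and each occurrence of $g\,q_1\dots q_{n_g}$ in $r$ (pattern variables bound in $r$ being named apart from the free ones). Write $p\bowtie q$ if $p$ and $q$ become unifiable after each occurrence of a variable or of $\_$ is replaced by its own fresh variable. The typed dependency graph has the dependency pairs as nodes, and an edge from $t\to g^\sharp(\vec p)$ to $h^\sharp(\vec q)\to u$ if $g=h$ and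 $p_i\bowtie q_i$ for all $i\le k_g$. Its strongly connected components are the maximal sets of nodes in which every node is reachable from every node, itself included, by a non-empty path (a node on no cycle is in no component). The embedding preorder $p\rhd q$ is the least relation on patterns with $\mathsf{node}(p_1,p_2)\rhd q$ if $p_1\unrhd q$ or $p_2\unrhd q$, and $\mathsf{node}(p_1,p_2)\rhd\mathsf{node}(q_1,q_2)$ if $p_1\rhd q_1$ and $p_2\unrhd q_2$, or $p_1\unrhd q_1$ and $p_2\rhd q_2$, restricted to patterns without $\_$; $\unrhd$ is its reflexive closure. **Theorem.** Suppose that for each strongly connected component $\mathcal C$ of the typed dependency graph of $\mathcal R$ there is an assignment $\iota$ of an index $1\le\iota_f\le k_f$ to each symbol $f$ that occurs in the pairs of $\mathcal C$, such that $p_{\iota_f}\unrhd q_{\iota_g}$ for every pair $f^\sharp(\vec p)\to g^\sharp(\vec q)$ in $\mathcal C$, and such that every cycle in $\mathcal C$ contains a pair $f^\sharp(\vec p)\to g^\sharp(\vec q)$ with $p_{\iota_f}\rhd q_{\iota_g}$. Then for all $\Gamma,t,T$ with $\Gamma\vdash t:T$, the erasure $|t|$ of $t$, which removes pattern arguments,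 pattern abstractions and type annotations, is strongly normalizing under the union of $\beta$-reduction and the rewriting with the erased rules $|l|\to|r|$, $l\to r\in\mathcal R$, both closed under all term contexts. -/

import Mathlib

namespace RefDP

/-! ### Patterns

Variables, both pattern variables and term variables, are represented by de Bruijn indices; indices
that point outside all binders are the free variables. -/

/-- Patterns `p, q ::= α | leaf | node(p, q) | _ | ⊥`. -/
inductive Pat : Type
  | var (a : ℕ)
  | leaf
  | node (p q : Pat)
  | wild
  | bot

namespace Pat

/-- The pattern variable `a` appears in a pattern. -/
def Occurs (a : ℕ) : Pat → Prop
  | var b => a = b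
  | leaf => False
  | node p q => p.Occurs a ∨ q.Occurs a
  | wild => False
  | bot => False

/-- The pattern has no occurrence of the wildcard. -/
def NoWild : Pat → Prop
  | var _ => True
  | leaf => True
  | node p q => p.NoWild ∧ q.NoWild
  | wild => False
  | bot => True

/-- Simultaneous substitution of patterns for pattern variables. -/
def subst (s : ℕ → Pat) : Pat → Pat
  | var a => s a
  | leaf => leaf
  | node p q => node (p.subst s) (q.subst s)
  | wild => wild
  | bot => bot

/-- Shift all variables by `d`. -/
def lift (d : ℕ) (p : Pat) : Pat := p.subst (fun a => var (a + d))

/-- Replace each occurrence of a variable and each occurrence of `_` by a fresh variable; the fresh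
variables are numbered from `c` on, and the next unused number is returned as well. -/
def freshen : Pat → ℕ → Pat × ℕ
  | var _, c => (var c, c + 1)
  | leaf, c => (leaf, c)
  | node p q, c =>
      (node (p.freshen c).1 (q.freshen (p.freshen c).2).1, (q.freshen (p.freshen c).2).2)
  | wild, c => (var c, c + 1)
  | bot, c => (bot, c)

/-- Pattern-unifiability `p ⋈ q`: after replacing every occurrence of a variable or of `_` in `p` and
in `q` by its own fresh variable, the two patterns are unifiable. -/
def Unifiable (p q : Pat) : Prop :=
  ∃ s : ℕ → Pat, (p.freshen 0).1.subst s = (q.freshen (p.freshen 0).2).1.subst s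

/-- The order `p ≪ q` on patterns. -/
inductive Le : Pat → Pat → Prop
  | wild (p : Pat) : Le p wild
  | var (a : ℕ) : Le (var a) (var a)
  | leaf : Le leaf leaf
  | node {p₁ p₂ q₁ q₂ : Pat} : Le p₁ q₁ → Le p₂ q₂ → Le (node p₁ p₂) (node q₁ q₂)
  | bot (p : Pat) : Le bot p

/-- The rules of the strict embedding preorder, before wildcards are excluded. A premise "strict or
equal" is split into its two cases. -/
inductive PreEmb : Pat → Pat → Prop
  | left_refl (p₁ p₂ : Pat) : PreEmb (node p₁ p₂) p₁
  | left {p₁ q : Pat} (p₂ : Pat) : PreEmb p₁ q → PreEmb (node p₁ p₂) q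
  | right_refl (p₁ p₂ : Pat) : PreEmb (node p₁ p₂) p₂
  | right {p₂ q : Pat} (p₁ : Pat) : PreEmb p₂ q → PreEmb (node p₁ p₂) q
  | node_left {p₁ q₁ : Pat} (p : Pat) : PreEmb p₁ q₁ → PreEmb (node p₁ p) (node q₁ p)
  | node_right {p₂ q₂ : Pat} (p : Pat) : PreEmb p₂ q₂ → PreEmb (node p p₂) (node p q₂)
  | node_both {p₁ p₂ q₁ q₂ : Pat} :
      PreEmb p₁ q₁ → PreEmb p₂ q₂ → PreEmb (node p₁ p₂) (node q₁ q₂)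

/-- The strict embedding preorder `p ▷ q`; neither side may contain `_`. -/
def Emb (p q : Pat) : Prop := PreEmb p q ∧ p.NoWild ∧ q.NoWild

/-- Its reflexive closure `p ⊵ q`. -/
def EmbEq (p q : Pat) : Prop := p = q ∨ Emb p q

end Pat

/-! ### Types -/

/-- Types `T, U ::= B(p) | T → U | ∀ α. T`; `all` binds the pattern variable `0`. -/
inductive Ty : Type
  | base (p : Pat)
  | arr (T U : Ty)
  | all (T : Ty)

namespace Ty

/-- The pattern variable `a` is free in a type. -/
def Free (a : ℕ) : Ty → Prop
  | base p => p.Occurs a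
  | arr T U => T.Free a ∨ U.Free a
  | all T => T.Free (a + 1)

/-- The pattern variable `a` appears positively (`pos = true`) or negatively (`pos = false`) in a
type; a variable may do both. -/
def Appears : (pos : Bool) → (a : ℕ) → Ty → Prop
  | pos, a, base p => pos = true ∧ p.Occurs a
  | pos, a, arr T U => T.Appears (!pos) a ∨ U.Appears pos a
  | pos, a, all T => T.Appears pos (a + 1)

/-- A substitution pushed under a binder. -/
def up (s : ℕ → Pat) : ℕ → Pat
  | 0 => Pat.var 0
  | a + 1 => (s a).lift 1

/-- Simultaneous capture-avoiding substitution. -/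
def subst : (ℕ → Pat) → Ty → Ty
  | s, base p => base (p.subst s)
  | s, arr T U => arr (T.subst s) (U.subst s)
  | s, all T => all (T.subst (up s))

/-- Shift all free pattern variables by one. -/
def shift (T : Ty) : Ty := T.subst (fun a => Pat.var (a + 1))

/-- The substitution that sends the `n` variables bound by `∀ α₁ … αₙ` to `p₁, …, pₙ`: the variable
`αₙ` has index `0` and `α₁` has index `n - 1`. -/
def instList (ps : List Pat) : ℕ → Pat :=
  fun a => ps.reverse.getD a (Pat.var (a - ps.length))

/-- `T[α := p]` for the body `T` of `∀ α. T`. -/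
def inst (p : Pat) (T : Ty) : Ty := T.subst (instList [p])

/-- Subtyping. -/
inductive Sub : Ty → Ty → Prop
  | base {p q : Pat} : p.Le q → Sub (base p) (base q)
  | arr {T₁ T₂ U₁ U₂ : Ty} : Sub T₂ T₁ → Sub U₁ U₂ → Sub (arr T₁ U₁) (arr T₂ U₂)
  | all {T U : Ty} : Sub T U → Sub (all T) (all U)

end Ty

/-! ### Signatures -/

/-- A type assignment `τ` for the function symbols `F`, given through
`τ_f = ∀ α₁ … αₙ. B(α₁) → … → B(αₖ) → T_f` with `k ≤ n`. The type `τ_f` is closed and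
`α₁, …, αₖ` appear only positively in `T_f`. The variable `αᵢ` has index `n - i` in `T_f`. -/
structure Signature (F : Type*) where
  /-- the number `n` of pattern arguments -/
  npat : F → ℕ
  /-- the number `k` of recursive arguments -/
  nrec : F → ℕ
  /-- the type `T_f` -/
  res : F → Ty
  nrec_le : ∀ f, nrec f ≤ npat f
  closed : ∀ f a, (res f).Free a → a < npat f
  positive : ∀ f i, i < nrec f → ¬ (res f).Appears false (npat f - 1 - i)

/-- The type `τ_f`. -/
def Signature.type {F : Type*} (S : Signature F) (f : F) : Ty :=
  Ty.all^[S.npat f]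
    ((List.range (S.nrec f)).foldr
      (fun i T => Ty.arr (Ty.base (Pat.var (S.npat f - 1 - i))) T) (S.res f))

/-! ### Terms and typing -/

/-- Terms with explicit pattern abstraction and application; `lam` binds the term variable `0` and
`plam` binds the pattern variable `0`. -/
inductive Tm (F : Type*)
  | var (x : ℕ)
  | sym (f : F)
  | app (t u : Tm F)
  | papp (t : Tm F) (p : Pat)
  | lam (T : Ty) (t : Tm F)
  | plam (t : Tm F)
  | node
  | leaf

namespace Tm

variable {F : Type*}

/-- `t u₁ … uₖ`. -/
def apps (t : Tm F) (us : List (Tm F)) : Tm F := us.foldl app t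

/-- `t p₁ … pₙ`. -/
def papps (t : Tm F) (ps : List Pat) : Tm F := ps.foldl papp t

/-- Free term variables. -/
def fv : Tm F → Set ℕ
  | var x => {x}
  | sym _ => ∅
  | app t u => t.fv ∪ u.fv
  | papp t _ => t.fv
  | lam _ t => {x | x + 1 ∈ t.fv}
  | plam t => t.fv
  | node => ∅
  | leaf => ∅

/-- `OccursIn s d t`: the term `s` occurs in `t` at a position below exactly `d` pattern
abstractions. -/
inductive OccursIn (s : Tm F) : ℕ → Tm F → Prop
  | here : OccursIn s 0 s
  | app_left {d : ℕ} {t : Tm F} (u : Tm F) : OccursIn s d t → OccursIn s d (app t u)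
  | app_right {d : ℕ} {u : Tm F} (t : Tm F) : OccursIn s d u → OccursIn s d (app t u)
  | papp {d : ℕ} {t : Tm F} (p : Pat) : OccursIn s d t → OccursIn s d (papp t p)
  | lam {d : ℕ} {t : Tm F} (T : Ty) : OccursIn s d t → OccursIn s d (lam T t)
  | plam {d : ℕ} {t : Tm F} : OccursIn s d t → OccursIn s (d + 1) (plam t)

/-- Every occurrence of a function symbol is applied to all its pattern arguments. -/
inductive FullyApplied (S : Signature F) : Tm F → Prop
  | call (g : F) (qs : List Pat) : qs.length = S.npat g → FullyApplied S (papps (sym g) qs)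
  | var (x : ℕ) : FullyApplied S (var x)
  | app {t u : Tm F} : FullyApplied S t → FullyApplied S u → FullyApplied S (app t u)
  | papp {t : Tm F} (p : Pat) : FullyApplied S t → FullyApplied S (papp t p)
  | lam {t : Tm F} (T : Ty) : FullyApplied S t → FullyApplied S (lam T t)
  | plam {t : Tm F} : FullyApplied S t → FullyApplied S (plam t)
  | node : FullyApplied S node
  | leaf : FullyApplied S leaf

end Tm

/-- A context lists the types of the term variables `0, 1, …`. -/
abbrev Ctx := List Ty

/-- The typing judgement `Γ ⊢ t : T`. -/
inductive HasType {F : Type*} (S : Signature F) : Ctx → Tm F → Ty → Prop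
  | ax {Γ : Ctx} {x : ℕ} {T : Ty} : Γ[x]? = some T → HasType S Γ (Tm.var x) T
  | t_lam {Γ : Ctx} {T U : Ty} {t : Tm F} :
      HasType S (T :: Γ) t U → HasType S Γ (Tm.lam T t) (Ty.arr T U)
  | p_lam {Γ : Ctx} {T : Ty} {t : Tm F} :
      HasType S (Γ.map Ty.shift) t T → HasType S Γ (Tm.plam t) (Ty.all T)
  | leaf_intro {Γ : Ctx} : HasType S Γ Tm.leaf (Ty.base Pat.leaf)
  | node_intro {Γ : Ctx} : HasType S Γ Tm.node
      (Ty.all (Ty.all (Ty.arr (Ty.base (Pat.var 1)) (Ty.arr (Ty.base (Pat.var 0))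
        (Ty.base (Pat.node (Pat.var 1) (Pat.var 0)))))))
  | t_app {Γ : Ctx} {T U : Ty} {t u : Tm F} :
      HasType S Γ t (Ty.arr T U) → HasType S Γ u T → HasType S Γ (Tm.app t u) U
  | p_app {Γ : Ctx} {T : Ty} {t : Tm F} (p : Pat) :
      HasType S Γ t (Ty.all T) → HasType S Γ (Tm.papp t p) (T.inst p)
  | symb {Γ : Ctx} (f : F) : HasType S Γ (Tm.sym f) (S.type f)
  | sub {Γ : Ctx} {T U : Ty} {t : Tm F} : HasType S Γ t T → Ty.Sub T U → HasType S Γ t U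

/-! ### Rewrite rules -/

/-- Constructor terms, with the pattern arguments of `Node` written out. -/
inductive CTm : Type
  | var (x : ℕ)
  | leaf
  | node (p₁ p₂ : Pat) (l₁ l₂ : CTm)

/-- A constructor term as a term. -/
def CTm.toTm (F : Type*) : CTm → Tm F
  | var x => Tm.var x
  | leaf => Tm.leaf
  | node p₁ p₂ l₁ l₂ =>
      Tm.app (Tm.app (Tm.papp (Tm.papp Tm.node p₁) p₂) (l₁.toTm F)) (l₂.toTm F)

/-- Minimal typing of constructor terms: `Γ ⊢min l : B(p)`. In the variable case the pattern variable
is not free in the type of any other variable of the context. -/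
inductive CTm.MinType (Γ : Ctx) : CTm → Pat → Prop
  | var {x a : ℕ} : Γ[x]? = some (Ty.base (Pat.var a)) →
      (∀ y T, y ≠ x → Γ[y]? = some T → ¬ T.Free a) → MinType Γ (CTm.var x) (Pat.var a)
  | leaf : MinType Γ CTm.leaf Pat.leaf
  | node {l₁ l₂ : CTm} {p₁ p₂ : Pat} : MinType Γ l₁ p₁ → MinType Γ l₂ p₂ →
      MinType Γ (CTm.node p₁ p₂ l₁ l₂) (Pat.node p₁ p₂)

/-- A rewrite rule `f p₁ … pₙ l₁ … lₖ → r`. -/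
structure Rule (F : Type*) where
  head : F
  pats : List Pat
  args : List CTm
  rhs : Tm F

namespace Rule

variable {F : Type*}

/-- The left-hand side `f p₁ … pₙ l₁ … lₖ`. -/
def lhs (r : Rule F) : Tm F :=
  ((Tm.sym r.head).papps r.pats).apps (r.args.map (CTm.toTm F))

/-- The syntactic conditions on rewrite rules. -/
structure IsRewriteRule (S : Signature F) (r : Rule F) : Prop where
  pats_length : r.pats.length = S.npat r.head
  args_length : r.args.length = S.nrec r.head
  fv_subset : r.rhs.fv ⊆ r.lhs.fv
  fully_applied : r.rhs.FullyApplied S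

/-- Minimal typing `Γ ⊢min f p₁ … pₖ β_{k+1} … βₙ l₁ … lₖ : T_f φ` of a left-hand side, where
`Γ ⊢min lᵢ : B(pᵢ)`, the `β`s are distinct pattern variables not free in `Γ`, and `φ` sends the bound
variables of `τ_f` to the pattern arguments. -/
structure MinTypeLhs (S : Signature F) (Γ : Ctx) (r : Rule F) (T : Ty) : Prop where
  args : List.Forall₂ (CTm.MinType Γ) r.args (r.pats.take (S.nrec r.head))
  rest : ∃ bs : List ℕ, r.pats.drop (S.nrec r.head) = bs.map Pat.var ∧ bs.Nodup ∧
    ∀ b ∈ bs, ∀ U ∈ Γ, ¬ U.Free b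
  type_eq : T = (S.res r.head).subst (Ty.instList r.pats)

/-- A rule is well-typed if, for some context and type, the left-hand side has this type minimally
and the right-hand side has it. -/
def WellTyped (S : Signature F) (r : Rule F) : Prop :=
  ∃ (Γ : Ctx) (T : Ty), r.MinTypeLhs S Γ T ∧ HasType S Γ r.rhs T

end Rule

/-! ### The typed dependency graph -/

/-- A type dependency pair `f♯(p₁, …, pₖ) → g♯(q₁, …, qₗ)`. -/
structure DepPair (F : Type*) where
  src : F
  srcArgs : List Pat
  tgt : F
  tgtArgs : List Pat

/-- The set of type dependency pairs of the rules `R`: one for each occurrence of a call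
`g q₁ … q_m` in a right-hand side; only the pattern arguments that belong to recursive arguments are
kept. For a minimally typed rule the first `k` pattern arguments of the left-hand side are the
patterns `pᵢ` with `Γ ⊢min lᵢ : B(pᵢ)`. If the call is below `d` pattern abstractions, then the
variables of the left-hand side are shifted by `d`, so that the pattern variables bound in the
right-hand side are different from those of the left-hand side. -/
def depPairs {F : Type*} (S : Signature F) (R : Set (Rule F)) : Set (DepPair F) :=
  {n | ∃ r ∈ R, ∃ (d : ℕ) (g : F) (qs : List Pat), qs.length = S.npat g ∧
    ((Tm.sym g).papps qs).OccursIn d r.rhs ∧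
    n = ⟨r.head, (r.pats.take (S.nrec r.head)).map (Pat.lift d), g, qs.take (S.nrec g)⟩}

/-- The edges of the standard typed dependency graph, whose set of nodes is `depPairs S R`. -/
def Edge {F : Type*} (S : Signature F) (R : Set (Rule F)) (m n : DepPair F) : Prop :=
  m ∈ depPairs S R ∧ n ∈ depPairs S R ∧ m.tgt = n.src ∧
    List.Forall₂ Pat.Unifiable m.tgtArgs n.srcArgs

/-- `C` is (the set of nodes of) a strongly connected component of the graph with edges `E`: a class
of nodes that reach each other. As in the dependency pair method, nodes reach each other
along non-empty paths, so a node that is on no cycle is in no component. -/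
def IsSCC {V : Type*} (E : V → V → Prop) (C : Set V) : Prop :=
  ∃ n ∈ C, ∀ m, m ∈ C ↔ Relation.TransGen E n m ∧ Relation.TransGen E m n

/-- The list of nodes `n :: l` is a cycle: each node has an edge to the next one, and the last one
has an edge to `n`. -/
def IsCycle {V : Type*} (E : V → V → Prop) (c : List V) : Prop :=
  ∃ n l, c = n :: l ∧ List.IsChain E (n :: l ++ [n])

/-- For the pair `f♯(p₁, …, pₖ) → g♯(q₁, …, qₗ)`, the indices `ι f` and `ι g` are indices of recursive
arguments of `f` and `g` (counted from `0`), and the patterns with these indices are in the relation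
`r`. -/
def DepPair.AtIndex {F : Type*} (n : DepPair F) (r : Pat → Pat → Prop) (ι : F → ℕ) : Prop :=
  ∃ p q, n.srcArgs[ι n.src]? = some p ∧ n.tgtArgs[ι n.tgt]? = some q ∧ r p q

/-! ### Erased terms and reduction -/

/-- Erased terms. -/
inductive ETm (F : Type*)
  | var (x : ℕ)
  | sym (f : F)
  | lam (t : ETm F)
  | app (t u : ETm F)
  | leaf
  | node

namespace ETm

variable {F : Type*}

/-- A renaming pushed under a binder. -/
def upRen (s : ℕ → ℕ) : ℕ → ℕ
  | 0 => 0
  | x + 1 => s x + 1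

/-- Renaming of term variables. -/
def rename : (ℕ → ℕ) → ETm F → ETm F
  | s, var x => var (s x)
  | _, sym f => sym f
  | s, lam t => lam (t.rename (upRen s))
  | s, app t u => app (t.rename s) (u.rename s)
  | _, leaf => leaf
  | _, node => node

/-- A substitution pushed under a binder. -/
def up (s : ℕ → ETm F) : ℕ → ETm F
  | 0 => var 0
  | x + 1 => (s x).rename Nat.succ

/-- Simultaneous capture-avoiding substitution. -/
def subst : (ℕ → ETm F) → ETm F → ETm F
  | s, var x => s x
  | _, sym f => sym f
  | s, lam t => lam (t.subst (up s))
  | s, app t u => app (t.subst s) (u.subst s)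
  | _, leaf => leaf
  | _, node => node

/-- The substitution of `u` for the variable `0`. -/
def single (u : ETm F) : ℕ → ETm F
  | 0 => u
  | x + 1 => var x

end ETm

/-- Erasure of pattern arguments, pattern abstractions and type annotations. -/
def Tm.erase {F : Type*} : Tm F → ETm F
  | var x => ETm.var x
  | sym f => ETm.sym f
  | app t u => ETm.app t.erase u.erase
  | papp t _ => t.erase
  | lam _ t => ETm.lam t.erase
  | plam t => t.erase
  | node => ETm.node
  | leaf => ETm.leaf

/-- Head rewriting with the erased rules. -/
def HeadRewrites {F : Type*} (R : Set (Rule F)) (t u : ETm F) : Prop :=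
  ∃ r ∈ R, ∃ s : ℕ → ETm F, r.lhs.erase.subst s = t ∧ r.rhs.erase.subst s = u

/-- One-step reduction: the closure of head rewriting and `β`-reduction by term contexts. -/
inductive Step {F : Type*} (R : Set (Rule F)) : ETm F → ETm F → Prop
  | head {t u : ETm F} : HeadRewrites R t u → Step R t u
  | beta (t u : ETm F) : Step R (ETm.app (ETm.lam t) u) (t.subst (ETm.single u))
  | app_left {t t' : ETm F} (u : ETm F) : Step R t t' → Step R (ETm.app t u) (ETm.app t' u)
  | app_right {u u' : ETm F} (t : ETm F) : Step R u u' → Step R (ETm.app t u) (ETm.app t u')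
  | lam {t t' : ETm F} : Step R t t' → Step R (ETm.lam t) (ETm.lam t')

/-- Strong normalization: the term is accessible for the inverse of reduction. -/
def SN {F : Type*} (R : Set (Rule F)) (t : ETm F) : Prop :=
  Acc (fun a b => Step R b a) t

end RefDP

/-! The proof is a reducibility argument in which patterns denote sets of finite tree
approximations. Under a valuation of the pattern variables by sets of observations containing the
trivial one, `B(p)` is interpreted as the strongly normalizing terms all of whose observations are
allowed by `p`; arrows are interpreted as usual, and quantifiers by intersection over all such sets.
The interpretations are reducibility candidates (`isCand_interp`), subtyping becomes inclusion, and
every typed term is computable once the function symbols are (`valid_of_sym`).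

A symbol applied to all its recursive arguments is neutral, so apart from steps inside the arguments
only a rewrite at the root matters. When a rule matches, each pattern variable of a constructor
argument is given exactly the observations of the term matched by its term variable. Minimal typing
makes the denotation of `pᵢ` equal to the observations of the `i`-th argument, hence contained in
the value assumed for `αᵢ`. Since `αᵢ` is not negative in `T_f`, computability of the right-hand
side at its own type suffices (`Rule.WellTyped.rhs_mem`). This in turn only needs each call in the
right-hand side to be computable at the denotations of its own pattern arguments
(`Tm.FullyApplied.valid`).

It remains to see that calls, as dependency pairs paired with valuations, are well-founded
(`wellFounded_follows`). Successive pairs are joined by an edge because inclusion of denotations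
forces pattern-unifiability (`Pat.unifiable_of_den_le`). There are finitely many pairs, so an
infinite chain revisits one of them forever and a tail stays in one component. Strong normalization
and finite branching bound the size of observations (`SN.bounded_obs`), so the pattern at the chosen
index has a finite measure, the maximal size of its observations. Along the tail this measure never
increases, and it drops on every cycle, which is impossible. -/

namespace RefDP

/-! ### Erased terms: substitution, application spines, neutral terms. -/

namespace ETm

variable {F : Type*}

theorem up_var : up (var : ℕ → ETm F) = var := by
  funext x; cases x <;> rfl

theorem subst_var (t : ETm F) : t.subst var = t := by
  induction t with
  | lam t ih => simp [subst, up_var, ih]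
  | app t u iht ihu => simp [subst, iht, ihu]
  | _ => rfl

theorem rename_subst (t : ETm F) (ρ : ℕ → ℕ) (s : ℕ → ETm F) :
    (t.rename ρ).subst s = t.subst (fun x => s (ρ x)) := by
  induction t generalizing ρ s with
  | lam t ih =>
    simp only [rename, subst, ih]
    congr 2; funext x; cases x <;> rfl
  | app t u iht ihu => simp [rename, subst, iht, ihu]
  | _ => rfl

theorem rename_rename (t : ETm F) (ρ ρ' : ℕ → ℕ) :
    (t.rename ρ).rename ρ' = t.rename (fun x => ρ' (ρ x)) := by
  induction t generalizing ρ ρ' with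
  | lam t ih =>
    simp only [rename, ih]
    congr 2; funext x; cases x <;> rfl
  | app t u iht ihu => simp [rename, iht, ihu]
  | _ => rfl

theorem subst_rename (t : ETm F) (s : ℕ → ETm F) (ρ : ℕ → ℕ) :
    (t.subst s).rename ρ = t.subst (fun x => (s x).rename ρ) := by
  induction t generalizing ρ s with
  | lam t ih =>
    simp only [rename, subst, ih]
    congr 2; funext x
    cases x with
    | zero => rfl
    | succ x => simp only [up, rename_rename]; rfl
  | app t u iht ihu => simp [rename, subst, iht, ihu]
  | _ => rfl

theorem up_subst_up (s s' : ℕ → ETm F) :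
    (fun x => (up s x).subst (up s')) = up (fun x => (s x).subst s') := by
  funext x
  cases x with
  | zero => rfl
  | succ x => simp only [up, rename_subst, subst_rename]

theorem subst_subst (t : ETm F) (s s' : ℕ → ETm F) :
    (t.subst s).subst s' = t.subst (fun x => (s x).subst s') := by
  induction t generalizing s s' with
  | lam t ih => simp only [subst, ih, up_subst_up]
  | app t u iht ihu => simp [subst, iht, ihu]
  | _ => rfl

/-- The substitution sending `0` to `u` and `x + 1` to `s x`. -/
def scons (u : ETm F) (s : ℕ → ETm F) : ℕ → ETm F
  | 0 => u
  | x + 1 => s x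

theorem subst_up_single (t u : ETm F) (s : ℕ → ETm F) :
    (t.subst (up s)).subst (single u) = t.subst (scons u s) := by
  rw [subst_subst]
  congr 1; funext x
  cases x with
  | zero => rfl
  | succ x =>
    simp only [up, rename_subst, scons]
    exact subst_var _

theorem subst_single_subst (t u : ETm F) (s : ℕ → ETm F) :
    (t.subst (single u)).subst s = (t.subst (up s)).subst (single (u.subst s)) := by
  rw [subst_up_single, subst_subst]
  congr 1; funext x
  cases x <;> rfl

/-- `t u₁ … uₖ`. -/
def apps (t : ETm F) (us : List (ETm F)) : ETm F := us.foldl app t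

theorem apps_concat (t : ETm F) (us : List (ETm F)) (u : ETm F) :
    t.apps (us ++ [u]) = app (t.apps us) u := by
  simp [apps]

theorem subst_apps (t : ETm F) (us : List (ETm F)) (s : ℕ → ETm F) :
    (t.apps us).subst s = (t.subst s).apps (us.map (subst s)) := by
  induction us generalizing t with
  | nil => rfl
  | cons u us ih => exact ih (app t u)

theorem apps_sym_cases {t : ETm F} {f : F} {us : List (ETm F)} (h : (sym f).apps us = t) :
    (us = [] ∧ t = sym f) ∨ ∃ vs v, us = vs ++ [v] ∧ t = app ((sym f).apps vs) v := by
  rcases List.eq_nil_or_concat us with rfl | ⟨vs, v, rfl⟩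
  · exact .inl ⟨rfl, h.symm⟩
  · exact .inr ⟨vs, v, by simp, by rw [← h]; simp [apps]⟩

theorem apps_sym_inj {f g : F} {us vs : List (ETm F)} (h : (sym f).apps us = (sym g).apps vs) :
    f = g ∧ us = vs := by
  induction us using List.reverseRecOn generalizing vs with
  | nil =>
    rcases apps_sym_cases h.symm with ⟨rfl, h'⟩ | ⟨ws, w, rfl, h'⟩
    · simpa [apps] using h'
    · cases h'
  | append_singleton us u ih =>
    rw [apps_concat] at h
    rcases apps_sym_cases h.symm with ⟨rfl, h'⟩ | ⟨ws, w, rfl, h'⟩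
    · cases h'
    · injection h' with h₁ h₂
      obtain ⟨rfl, rfl⟩ := ih h₁
      exact ⟨rfl, by rw [h₂]⟩

/-- The terms that are not neutral: abstractions, constructor terms, and function symbols with
too few arguments. -/
inductive IsValue (S : Signature F) : ETm F → Prop
  | lam (t : ETm F) : IsValue S (lam t)
  | leaf : IsValue S leaf
  | node₀ : IsValue S node
  | node₁ (a : ETm F) : IsValue S (app node a)
  | node₂ (a b : ETm F) : IsValue S (app (app node a) b)
  | part (f : F) (us : List (ETm F)) : us.length < S.nrec f → IsValue S ((sym f).apps us)

/-- In contrapositive form, neutrality is inherited by applications, which the arrow case of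
`isCand_interp` needs. -/
theorem IsValue.of_app {S : Signature F} {t u : ETm F} (h : IsValue S (app t u)) :
    IsValue S t := by
  generalize hs : app t u = s at h
  cases h with
  | node₁ a => injection hs with h₁ h₂; subst h₁; exact .node₀
  | node₂ a b => injection hs with h₁ h₂; subst h₁; exact .node₁ _
  | part f us hl =>
    rcases apps_sym_cases hs.symm with ⟨rfl, h'⟩ | ⟨ws, w, rfl, h'⟩
    · cases h'
    · injection h' with h₁ h₂
      subst h₁
      exact .part f ws (by simp at hl; omega)
  | _ => cases hs

theorem not_isValue_var (S : Signature F) (x : ℕ) : ¬ IsValue S (var x : ETm F) := by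
  intro h
  generalize hs : (var x : ETm F) = s at h
  cases h with
  | part f us hl =>
    rcases apps_sym_cases hs.symm with ⟨rfl, h'⟩ | ⟨ws, w, rfl, h'⟩ <;> cases h'
  | _ => cases hs

/-- This lets computability of a complete call be decided by its one-step reducts. -/
theorem not_isValue_apps {S : Signature F} {f : F} {us : List (ETm F)}
    (hl : us.length = S.nrec f) : ¬ IsValue S ((sym f).apps us) := by
  intro h
  generalize hs : (sym f).apps us = s at h
  cases h with
  | part g vs hv =>
    obtain ⟨rfl, rfl⟩ := apps_sym_inj hs
    omega
  | node₂ a b =>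
    rcases apps_sym_cases hs with ⟨rfl, h'⟩ | ⟨ws, w, rfl, h'⟩
    · cases h'
    · injection h' with h₁ h₂
      rcases apps_sym_cases h₁.symm with ⟨rfl, h'⟩ | ⟨ws, w, rfl, h'⟩
      · cases h'
      · injection h' with h₁ h₂
        rcases apps_sym_cases h₁.symm with ⟨rfl, h'⟩ | ⟨ws, w, rfl, h'⟩ <;> cases h'
  | node₁ a =>
    rcases apps_sym_cases hs with ⟨rfl, h'⟩ | ⟨ws, w, rfl, h'⟩
    · cases h'
    · injection h' with h₁ h₂
      rcases apps_sym_cases h₁.symm with ⟨rfl, h'⟩ | ⟨ws, w, rfl, h'⟩ <;> cases h'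
  | _ => rcases apps_sym_cases hs with ⟨rfl, h'⟩ | ⟨ws, w, rfl, h'⟩ <;> cases h'

end ETm

open ETm

/-! ### Shapes of reducts, and finite branching of reduction. -/

section Reduction

variable {F : Type*}

theorem Tm.erase_papps (t : Tm F) (ps : List Pat) : (t.papps ps).erase = t.erase := by
  induction ps generalizing t with
  | nil => rfl
  | cons p ps ih => exact ih (t.papp p)

theorem Tm.erase_apps (t : Tm F) (us : List (Tm F)) :
    (t.apps us).erase = t.erase.apps (us.map erase) := by
  induction us generalizing t with
  | nil => rfl
  | cons p ps ih => exact ih (t.app p)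

theorem Rule.erase_lhs (r : Rule F) :
    r.lhs.erase = (sym r.head).apps (r.args.map fun l => (l.toTm F).erase) := by
  simp only [lhs, Tm.erase_apps, Tm.erase_papps, List.map_map]
  rfl

theorem Rule.erase_lhs_subst (r : Rule F) (s : ℕ → ETm F) :
    r.lhs.erase.subst s =
      (sym r.head).apps (r.args.map fun l => (l.toTm F).erase.subst s) := by
  rw [erase_lhs, subst_apps, List.map_map]
  rfl

theorem Tm.fv_papps (t : Tm F) (ps : List Pat) : (t.papps ps).fv = t.fv := by
  induction ps generalizing t with
  | nil => rfl
  | cons p ps ih => exact ih (t.papp p)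

theorem Tm.mem_fv_apps {t : Tm F} {us : List (Tm F)} {x : ℕ} :
    x ∈ (t.apps us).fv ↔ x ∈ t.fv ∨ ∃ u ∈ us, x ∈ u.fv := by
  induction us generalizing t with
  | nil => simp [apps]
  | cons u us ih =>
    refine (ih (t := t.app u)).trans ?_
    simp [fv, or_assoc]

theorem Rule.mem_fv_lhs {r : Rule F} {x : ℕ} :
    x ∈ r.lhs.fv ↔ ∃ l ∈ r.args, x ∈ (l.toTm F).fv := by
  simp [lhs, Tm.mem_fv_apps, Tm.fv_papps, Tm.fv]

theorem Tm.erase_subst_congr {t : Tm F} {s s' : ℕ → ETm F} (h : ∀ x ∈ t.fv, s x = s' x) :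
    t.erase.subst s = t.erase.subst s' := by
  induction t generalizing s s' with
  | var x => exact h x rfl
  | app t u iht ihu =>
    simp only [erase, ETm.subst]
    rw [iht fun x hx => h x (.inl hx), ihu fun x hx => h x (.inr hx)]
  | papp t p ih => exact ih h
  | plam t ih => exact ih h
  | lam T t ih =>
    simp only [erase, ETm.subst]
    rw [ih]
    intro x hx
    cases x with
    | zero => rfl
    | succ x => simp only [ETm.up]; rw [h x hx]
  | _ => rfl

/-- Matching is deterministic: the matched term fixes the substitution on the variables of the
constructor term. Hence a rule has at most one contractum at a given redex. -/
theorem CTm.eq_of_subst_eq {l : CTm} {s s' : ℕ → ETm F}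
    (h : (l.toTm F).erase.subst s = (l.toTm F).erase.subst s') :
    ∀ x ∈ (l.toTm F).fv, s x = s' x := by
  induction l with
  | var y => rintro x rfl; exact h
  | leaf => rintro x ⟨⟩
  | node p₁ p₂ l₁ l₂ ih₁ ih₂ =>
    simp only [toTm, Tm.erase, ETm.subst, ETm.app.injEq, true_and] at h
    intro x hx
    simp only [toTm, Tm.fv, Set.empty_union] at hx
    exact hx.elim (ih₁ h.1 x) (ih₂ h.2 x)

variable {R : Set (Rule F)}

theorem Step.subst {t u : ETm F} (h : Step R t u) (s : ℕ → ETm F) :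
    Step R (t.subst s) (u.subst s) := by
  induction h generalizing s with
  | head h =>
    obtain ⟨r, hr, s', rfl, rfl⟩ := h
    exact .head ⟨r, hr, _, (subst_subst ..).symm, (subst_subst ..).symm⟩
  | beta t u => rw [subst_single_subst]; exact .beta _ _
  | app_left u _ ih => exact .app_left _ (ih s)
  | app_right t _ ih => exact .app_right _ (ih s)
  | lam _ ih => exact .lam (ih _)

theorem SN.step {t u : ETm F} (h : SN R t) (hs : Step R t u) : SN R u := h.inv hs

theorem SN.induct {t : ETm F} (h : SN R t) {P : ETm F → Prop}
    (ih : ∀ t, SN R t → (∀ u, Step R t u → P u) → P t) : P t := by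
  induction h with
  | intro t ht ih' => exact ih t ⟨t, ht⟩ ih'

theorem SN.of_map {t : ETm F} (g : ETm F → ETm F) (hg : ∀ t u, Step R t u → Step R (g t) (g u))
    (h : SN R (g t)) : SN R t := by
  generalize he : g t = s at h
  induction h generalizing t with
  | intro s _ ih =>
    subst he
    exact ⟨t, fun u hu => ih _ (hg _ _ hu) rfl⟩

theorem SN.app_left {t u : ETm F} (h : SN R (app t u)) : SN R t :=
  h.of_map (fun t => app t u) fun _ _ => .app_left u

theorem SN.app_right {t u : ETm F} (h : SN R (app t u)) : SN R u :=
  h.of_map (app t) fun _ _ => .app_right t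

theorem SN.of_subst {t : ETm F} {s : ℕ → ETm F} (h : SN R (t.subst s)) : SN R t :=
  h.of_map (ETm.subst s) fun _ _ hs => hs.subst s

theorem HeadRewrites.spine {t u : ETm F} (h : HeadRewrites R t u) :
    ∃ f us, t = (sym f).apps us := by
  obtain ⟨r, _, s, rfl, _⟩ := h
  exact ⟨_, _, r.erase_lhs_subst s⟩

theorem not_headRewrites_lam {t u : ETm F} : ¬ HeadRewrites R (lam t) u := by
  intro h
  obtain ⟨f, us, hs⟩ := h.spine
  rcases apps_sym_cases hs.symm with ⟨_, h'⟩ | ⟨_, _, _, h'⟩ <;> cases h'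

theorem Step.leaf_false {u : ETm F} (h : Step R leaf u) : False := by
  cases h with
  | head h =>
    obtain ⟨f, us, hs⟩ := h.spine
    rcases apps_sym_cases hs.symm with ⟨_, h'⟩ | ⟨_, _, _, h'⟩ <;> cases h'

theorem Step.node_false {u : ETm F} (h : Step R node u) : False := by
  cases h with
  | head h =>
    obtain ⟨f, us, hs⟩ := h.spine
    rcases apps_sym_cases hs.symm with ⟨_, h'⟩ | ⟨_, _, _, h'⟩ <;> cases h'

theorem Step.var_false {x : ℕ} {u : ETm F} (h : Step R (var x) u) : False := by
  cases h with
  | head h =>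
    obtain ⟨f, us, hs⟩ := h.spine
    rcases apps_sym_cases hs.symm with ⟨_, h'⟩ | ⟨_, _, _, h'⟩ <;> cases h'

theorem Step.of_lam {t u : ETm F} (h : Step R (ETm.lam t) u) : ∃ t', u = ETm.lam t' ∧ Step R t t' := by
  cases h with
  | head h => exact (not_headRewrites_lam h).elim
  | lam h => exact ⟨_, rfl, h⟩

theorem Step.of_app_lam {t u v : ETm F} (h : Step R (app (ETm.lam t) u) v) :
    v = t.subst (single u) ∨ (∃ t', v = app (ETm.lam t') u ∧ Step R t t') ∨
      ∃ u', v = app (ETm.lam t) u' ∧ Step R u u' := by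
  cases h with
  | head h =>
    obtain ⟨f, us, hs⟩ := h.spine
    rcases apps_sym_cases hs.symm with ⟨_, h'⟩ | ⟨ws, _, _, h'⟩
    · cases h'
    · injection h' with h₁ h₂
      rcases apps_sym_cases h₁.symm with ⟨_, h'⟩ | ⟨_, _, _, h'⟩ <;> cases h'
  | beta => exact .inl rfl
  | app_left _ h => obtain ⟨t', rfl, ht⟩ := h.of_lam; exact .inr (.inl ⟨t', rfl, ht⟩)
  | app_right _ h => exact .inr (.inr ⟨_, rfl, h⟩)

theorem Step.of_node₁ {a u : ETm F} (h : Step R (app node a) u) :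
    ∃ a', u = app node a' ∧ Step R a a' := by
  cases h with
  | head h =>
    obtain ⟨f, us, hs⟩ := h.spine
    rcases apps_sym_cases hs.symm with ⟨_, h'⟩ | ⟨_, _, _, h'⟩
    · cases h'
    · injection h' with h₁ h₂
      rcases apps_sym_cases h₁.symm with ⟨_, h'⟩ | ⟨_, _, _, h'⟩ <;> cases h'
  | app_left _ h => exact h.node_false.elim
  | app_right _ h => exact ⟨_, rfl, h⟩

theorem Step.of_node₂ {a b u : ETm F} (h : Step R (app (app node a) b) u) :
    (∃ a', u = app (app node a') b ∧ Step R a a') ∨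
      ∃ b', u = app (app node a) b' ∧ Step R b b' := by
  cases h with
  | head h =>
    obtain ⟨f, us, hs⟩ := h.spine
    rcases apps_sym_cases hs.symm with ⟨_, h'⟩ | ⟨_, _, _, h'⟩
    · cases h'
    · injection h' with h₁ h₂
      rcases apps_sym_cases h₁.symm with ⟨_, h'⟩ | ⟨_, _, _, h'⟩
      · cases h'
      · injection h' with h₁ h₂
        rcases apps_sym_cases h₁.symm with ⟨_, h'⟩ | ⟨_, _, _, h'⟩ <;> cases h'
  | app_left _ h => obtain ⟨a', rfl, ha⟩ := h.of_node₁; exact .inl ⟨a', rfl, ha⟩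
  | app_right _ h => exact .inr ⟨_, rfl, h⟩

variable {S : Signature F}

theorem HeadRewrites.length (hR : ∀ r ∈ R, r.IsRewriteRule S) {f : F} {us : List (ETm F)}
    {v : ETm F} (h : HeadRewrites R ((sym f).apps us) v) : us.length = S.nrec f := by
  obtain ⟨r, hr, s, h, _⟩ := h
  rw [r.erase_lhs_subst] at h
  obtain ⟨rfl, rfl⟩ := apps_sym_inj h
  simpa using (hR r hr).args_length

/-- A rule applies to exactly `nrec` arguments, so a rewrite at the root would make the function
part a symbol lacking one argument, which is a value. -/
theorem Step.of_neutral_app (hR : ∀ r ∈ R, r.IsRewriteRule S) {t u v : ETm F}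
    (ht : ¬ IsValue S t) (h : Step R (app t u) v) :
    (∃ t', v = app t' u ∧ Step R t t') ∨ ∃ u', v = app t u' ∧ Step R u u' := by
  cases h with
  | head h =>
    obtain ⟨f, us, hs⟩ := h.spine
    rw [hs] at h
    have hl := h.length hR
    rcases apps_sym_cases hs.symm with ⟨_, h'⟩ | ⟨ws, w, rfl, h'⟩
    · cases h'
    · injection h' with h₁ h₂
      subst h₁
      exact (ht (.part f ws (by simp at hl; omega))).elim
  | beta => exact (ht (.lam _)).elim
  | app_left _ h => exact .inl ⟨_, rfl, h⟩
  | app_right _ h => exact .inr ⟨_, rfl, h⟩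

/-- One reduction step in one element of a list. -/
inductive ListStep (R : Set (Rule F)) : List (ETm F) → List (ETm F) → Prop
  | head {u u' : ETm F} (us : List (ETm F)) : Step R u u' → ListStep R (u :: us) (u' :: us)
  | tail (u : ETm F) {us us' : List (ETm F)} : ListStep R us us' → ListStep R (u :: us) (u :: us')

theorem ListStep.concat_left {us us' : List (ETm F)} (h : ListStep R us us') (u : ETm F) :
    ListStep R (us ++ [u]) (us' ++ [u]) := by
  induction h with
  | head us h => exact .head _ h
  | tail v _ ih => exact .tail v ih

theorem ListStep.concat_right (us : List (ETm F)) {u u' : ETm F} (h : Step R u u') :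
    ListStep R (us ++ [u]) (us ++ [u']) := by
  induction us with
  | nil => exact .head _ h
  | cons v us ih => exact .tail v ih

theorem ListStep.forall₂ {ι : Type*} {P : ι → ETm F → Prop}
    (hP : ∀ i t u, P i t → Step R t u → P i u) {us us' : List (ETm F)} (h : ListStep R us us')
    {is : List ι} (hf : List.Forall₂ P is us) : List.Forall₂ P is us' := by
  induction h generalizing is with
  | head us h =>
    cases hf with
    | cons h₁ h₂ => exact .cons (hP _ _ _ h₁ h) h₂
  | tail v _ ih =>
    cases hf with
    | cons h₁ h₂ => exact .cons h₁ (ih h₂)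

/-- Each step changes either the head or the tail and keeps the other, so nested inductions on the
two suffice. -/
theorem acc_listStep {us : List (ETm F)} (h : ∀ u ∈ us, SN R u) :
    Acc (fun a b => ListStep R b a) us := by
  induction us with
  | nil => exact ⟨_, fun _ h => nomatch h⟩
  | cons u us ih =>
    have hu : SN R u := h u (by simp)
    have hus := ih fun v hv => h v (by simp [hv])
    clear h ih
    induction hu generalizing us with
    | intro u hu ihu =>
      induction hus with
      | intro us hus ihus =>
        refine ⟨_, fun vs hvs => ?_⟩
        cases hvs with
        | head _ h => exact ihu _ h _ ⟨us, hus⟩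
        | tail _ h => exact ihus _ h

/-- A proper prefix of the spine has fewer than `nrec` arguments and so is no redex; only the whole
term can be rewritten by a rule. -/
theorem Step.of_apps_sym (hR : ∀ r ∈ R, r.IsRewriteRule S) {f : F} {us : List (ETm F)}
    {v : ETm F} (hl : us.length ≤ S.nrec f) (h : Step R ((sym f).apps us) v) :
    HeadRewrites R ((sym f).apps us) v ∨ ∃ us', v = (sym f).apps us' ∧ ListStep R us us' := by
  induction us using List.reverseRecOn generalizing v with
  | nil =>
    change Step R (sym f) v at h
    cases h with
    | head h => exact .inl h
  | append_singleton us u ih =>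
    rw [apps_concat] at h
    generalize hw : app ((sym f).apps us) u = w at h
    simp only [List.length_append, List.length_singleton] at hl
    cases h with
    | head h => left; rw [apps_concat, hw]; exact h
    | beta =>
      injection hw with h₁ h₂
      rcases apps_sym_cases h₁ with ⟨_, h'⟩ | ⟨_, _, _, h'⟩ <;> cases h'
    | app_left _ h =>
      injection hw with h₁ h₂
      subst h₁ h₂
      rcases ih (by omega) h with hh | ⟨us', rfl, hs⟩
      · have := hh.length hR; omega
      · exact .inr ⟨us' ++ [_], by rw [apps_concat], hs.concat_left _⟩
    | app_right _ h =>
      injection hw with h₁ h₂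
      subst h₁ h₂
      exact .inr ⟨us ++ [_], by rw [apps_concat], ListStep.concat_right us h⟩
    | lam h => cases hw

theorem finite_headRewrites (hfin : R.Finite) (hR : ∀ r ∈ R, r.IsRewriteRule S) (t : ETm F) :
    {u | HeadRewrites R t u}.Finite := by
  have : {u | HeadRewrites R t u} =
      ⋃ r ∈ R, {u | ∃ s : ℕ → ETm F, r.lhs.erase.subst s = t ∧ r.rhs.erase.subst s = u} := by
    ext u; simp [HeadRewrites]
  rw [this]
  refine hfin.biUnion fun r hr => Set.Subsingleton.finite ?_
  rintro _ ⟨s, hs, rfl⟩ _ ⟨s', hs', rfl⟩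
  refine Tm.erase_subst_congr fun x hx => ?_
  obtain ⟨l, hl, hx⟩ := Rule.mem_fv_lhs.1 ((hR r hr).fv_subset hx)
  rw [← hs', r.erase_lhs_subst, r.erase_lhs_subst] at hs
  have := List.map_inj_left.1 (apps_sym_inj hs).2 l hl
  exact CTm.eq_of_subst_eq this x hx

/-- Finite branching turns strong normalization into a bound on the observable tree, the source of
the termination measure. -/
theorem finite_step (hfin : R.Finite) (hR : ∀ r ∈ R, r.IsRewriteRule S) (t : ETm F) :
    {u | Step R t u}.Finite := by
  have hh := finite_headRewrites hfin hR
  induction t with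
  | lam t ih =>
    refine (ih.image lam).subset ?_
    intro u hu
    obtain ⟨t', rfl, h⟩ := Step.of_lam hu
    exact ⟨t', h, rfl⟩
  | app t u iht ihu =>
    have hb : {v | ∃ t', t = lam t' ∧ v = t'.subst (single u)}.Finite := by
      refine Set.Subsingleton.finite ?_
      rintro _ ⟨s, hs, rfl⟩ _ ⟨s', hs', rfl⟩
      rw [hs] at hs'; injection hs' with h; rw [h]
    refine ((hh (app t u)).union (hb.union
      ((iht.image fun t' => app t' u).union (ihu.image (app t))))).subset ?_
    intro v hv
    cases hv with
    | head h => exact .inl h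
    | beta t' _ => exact .inr (.inl ⟨t', rfl, rfl⟩)
    | app_left _ h => exact .inr (.inr (.inl ⟨_, h, rfl⟩))
    | app_right _ h => exact .inr (.inr (.inr ⟨_, h, rfl⟩))
  | var x => exact (hh _).subset fun u hu => by cases hu; assumption
  | sym f => exact (hh _).subset fun u hu => by cases hu; assumption
  | leaf => exact (hh _).subset fun u hu => by cases hu; assumption
  | node => exact (hh _).subset fun u hu => by cases hu; assumption

end Reduction

/-! ### Observations -/

/-- Finite approximations of the binary trees to which a term may reduce. -/
inductive Obs : Type
  | bot
  | leaf
  | node (o₁ o₂ : Obs)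

/-- The number of inner nodes. -/
def Obs.size : Obs → ℕ
  | bot => 0
  | leaf => 0
  | node o₁ o₂ => o₁.size + o₂.size + 1

/-- Sets of observations that contain the trivial one. -/
abbrev Dom : Type := {d : Set Obs // Obs.bot ∈ d}

namespace Dom

/-- The trivial domain. -/
def bot : Dom := ⟨{Obs.bot}, rfl⟩

/-- Extension of a valuation by a value for the variable `0`. -/
def cons (d : Dom) (θ : ℕ → Dom) : ℕ → Dom
  | 0 => d
  | a + 1 => θ a

end Dom

namespace Pat

/-- The observations allowed by a pattern under a valuation of its variables. -/
def den (θ : ℕ → Dom) : Pat → Dom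
  | var a => θ a
  | leaf => ⟨{.bot, .leaf}, by simp⟩
  | node p q => ⟨{o | o = .bot ∨ ∃ o₁ ∈ (p.den θ).1, ∃ o₂ ∈ (q.den θ).1, o = .node o₁ o₂}, .inl rfl⟩
  | wild => ⟨Set.univ, trivial⟩
  | bot => Dom.bot

theorem den_subst (p : Pat) (s : ℕ → Pat) (θ : ℕ → Dom) :
    (p.subst s).den θ = p.den (fun a => (s a).den θ) := by
  induction p with
  | node p q ihp ihq => simp [subst, den, ihp, ihq]
  | _ => rfl

theorem den_lift (p : Pat) (d : ℕ) (θ : ℕ → Dom) :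
    (p.lift d).den θ = p.den (fun a => θ (a + d)) :=
  p.den_subst _ θ

theorem den_node_mono {p₁ p₂ q₁ q₂ : Pat} {θ θ' : ℕ → Dom} (h₁ : p₁.den θ ≤ q₁.den θ')
    (h₂ : p₂.den θ ≤ q₂.den θ') : (node p₁ p₂).den θ ≤ (node q₁ q₂).den θ' := by
  rintro o (rfl | ⟨o₁, ho₁, o₂, ho₂, rfl⟩)
  · exact .inl rfl
  · exact .inr ⟨o₁, h₁ ho₁, o₂, h₂ ho₂, rfl⟩

theorem den_mono {p : Pat} {θ θ' : ℕ → Dom} (h : ∀ a, p.Occurs a → θ a ≤ θ' a) :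
    p.den θ ≤ p.den θ' := by
  induction p with
  | var a => exact h a rfl
  | node p q ihp ihq =>
    exact den_node_mono (ihp fun a ha => h a (.inl ha)) (ihq fun a ha => h a (.inr ha))
  | _ => exact le_rfl

/-- The clause for `⊥` is where it matters that every domain contains the trivial observation. -/
theorem Le.den {p q : Pat} (h : p.Le q) (θ : ℕ → Dom) : p.den θ ≤ q.den θ := by
  induction h with
  | wild p => exact fun _ _ => trivial
  | node _ _ ih₁ ih₂ => exact den_node_mono ih₁ ih₂
  | bot p => rintro _ rfl; exact (p.den θ).2
  | _ => exact le_rfl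

end Pat

section Observations

variable {F : Type*} {R : Set (Rule F)}

/-- The observation can be made of some reduct of the term. -/
inductive HasObs (R : Set (Rule F)) : ETm F → Obs → Prop
  | bot (t : ETm F) : HasObs R t .bot
  | leaf : HasObs R .leaf .leaf
  | node {a b : ETm F} {o₁ o₂ : Obs} : HasObs R a o₁ → HasObs R b o₂ →
      HasObs R (app (app .node a) b) (.node o₁ o₂)
  | step {t u : ETm F} {o : Obs} : Step R t u → HasObs R u o → HasObs R t o

/-- All observations of a term. -/
def obs (R : Set (Rule F)) (t : ETm F) : Dom := ⟨{o | HasObs R t o}, .bot t⟩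

theorem obs_step {t u : ETm F} (h : Step R t u) : obs R u ≤ obs R t :=
  fun _ ho => HasObs.step h ho

theorem obs_leaf (θ : ℕ → Dom) : obs R leaf = Pat.leaf.den θ := by
  refine Subtype.ext (Set.ext fun o => ⟨fun h => ?_, ?_⟩)
  · change HasObs R leaf o at h
    cases h with
    | bot => exact .inl rfl
    | leaf => exact .inr rfl
    | step h _ => exact h.leaf_false.elim
  · rintro (rfl | rfl)
    · exact .bot _
    · exact .leaf

/-- A constructor term reduces only inside its arguments, so the steps leading to an observation can
be sorted into those of `a` and those of `b`. -/
theorem HasObs.of_node {a b : ETm F} {o : Obs} (h : HasObs R (app (app .node a) b) o) :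
    o = .bot ∨ ∃ o₁, HasObs R a o₁ ∧ ∃ o₂, HasObs R b o₂ ∧ o = .node o₁ o₂ := by
  generalize ht : app (app ETm.node a) b = t at h
  induction h generalizing a b with
  | bot => exact .inl rfl
  | leaf => cases ht
  | node h₁ h₂ =>
    injection ht with ha hb
    injection ha with _ ha
    subst ha hb
    exact .inr ⟨_, h₁, _, h₂, rfl⟩
  | step hs h ih =>
    subst ht
    rcases hs.of_node₂ with ⟨a', rfl, ha⟩ | ⟨b', rfl, hb⟩
    · rcases ih rfl with h | ⟨o₁, h₁, o₂, h₂, rfl⟩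
      · exact .inl h
      · exact .inr ⟨o₁, .step ha h₁, o₂, h₂, rfl⟩
    · rcases ih rfl with h | ⟨o₁, h₁, o₂, h₂, rfl⟩
      · exact .inl h
      · exact .inr ⟨o₁, h₁, o₂, .step hb h₂, rfl⟩

/-- Equality, not just inclusion, is what makes minimal typing exact in `CTm.MinType.obs_eq`. -/
theorem obs_node {a b : ETm F} {p q : Pat} {θ : ℕ → Dom} (ha : obs R a = p.den θ)
    (hb : obs R b = q.den θ) : obs R (app (app .node a) b) = (Pat.node p q).den θ := by
  refine Subtype.ext (Set.ext fun o => ⟨fun h => ?_, ?_⟩)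
  · rcases HasObs.of_node h with rfl | ⟨o₁, h₁, o₂, h₂, rfl⟩
    · exact .inl rfl
    · exact .inr ⟨o₁, ha ▸ h₁, o₂, hb ▸ h₂, rfl⟩
  · rintro (rfl | ⟨o₁, h₁, o₂, h₂, rfl⟩)
    · exact .bot _
    · rw [← ha] at h₁
      rw [← hb] at h₂
      exact .node h₁ h₂

/-- The observations have bounded size. -/
def Dom.Bounded (d : Dom) : Prop := ∃ N, ∀ o ∈ d.1, o.size ≤ N

/-- The first term is reached from the second one by taking arguments of `node`. -/
inductive Child : ETm F → ETm F → Prop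
  | refl (t : ETm F) : Child t t
  | left {a b t : ETm F} : Child (app (app .node a) b) t → Child a t
  | right {a b t : ETm F} : Child (app (app .node a) b) t → Child b t

theorem Child.step {s s' t : ETm F} (h : Child s t) (hs : Step R s s') :
    ∃ t', Step R t t' ∧ Child s' t' := by
  induction h generalizing s' with
  | refl t => exact ⟨s', hs, .refl _⟩
  | left _ ih =>
    obtain ⟨t', ht, hc⟩ := ih (.app_left _ (.app_right _ hs))
    exact ⟨t', ht, hc.left⟩
  | right _ ih =>
    obtain ⟨t', ht, hc⟩ := ih (.app_right _ hs)
    exact ⟨t', ht, hc.right⟩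

/-- An observation is made either after a step, where finitely many reducts have a common bound, or
at once on a constructor, where the bounds of the arguments add up. -/
theorem bounded_obs_of_step (hfin : ∀ t : ETm F, {u | Step R t u}.Finite) {t : ETm F}
    (hs : ∀ u, Step R t u → (obs R u).Bounded)
    (hn : ∀ a b, t = app (app .node a) b → (obs R a).Bounded ∧ (obs R b).Bounded) :
    (obs R t).Bounded := by
  obtain ⟨N, hN⟩ : ∃ N, ∀ u, Step R t u → ∀ o ∈ (obs R u).1, o.size ≤ N := by
    choose! g hg using hs
    obtain ⟨N, hN⟩ := ((hfin t).image g).bddAbove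
    exact ⟨N, fun u hu o ho => (hg u hu o ho).trans (hN ⟨u, hu, rfl⟩)⟩
  obtain ⟨M, hM⟩ : ∃ M, ∀ a b, t = app (app .node a) b → ∀ o₁ ∈ (obs R a).1,
      ∀ o₂ ∈ (obs R b).1, o₁.size + o₂.size + 1 ≤ M := by
    by_cases h : ∃ a b, t = app (app .node a) b
    · obtain ⟨a, b, rfl⟩ := h
      obtain ⟨⟨A, hA⟩, ⟨B, hB⟩⟩ := hn a b rfl
      refine ⟨A + B + 1, fun a' b' he o₁ h₁ o₂ h₂ => ?_⟩
      injection he with ha hb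
      injection ha with _ ha
      subst ha hb
      have := hA o₁ h₁
      have := hB o₂ h₂
      omega
    · exact ⟨0, fun a b he => (h ⟨a, b, he⟩).elim⟩
  refine ⟨max N M, fun o ho => ?_⟩
  change HasObs R t o at ho
  cases ho with
  | bot => exact Nat.zero_le _
  | leaf => exact Nat.zero_le _
  | node h₁ h₂ => exact (hM _ _ rfl _ h₁ _ h₂).trans (le_max_right _ _)
  | step h ho => exact (hN _ h _ ho).trans (le_max_left _ _)

/-- A step of a descendant lifts to a step of `t`, so `ih` handles its reducts. Its own `node`
arguments are smaller descendants, reached by recursion on term size. -/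
theorem bounded_obs_of_child (hfin : ∀ t : ETm F, {u | Step R t u}.Finite) {t : ETm F}
    (ih : ∀ t', Step R t t' → ∀ s, Child s t' → (obs R s).Bounded) :
    ∀ s, Child s t → (obs R s).Bounded
  | s, hs => by
    refine bounded_obs_of_step hfin (fun u hu => ?_) (fun a b he => ?_)
    · obtain ⟨t', ht, hc⟩ := hs.step hu
      exact ih t' ht u hc
    · subst he
      exact ⟨bounded_obs_of_child hfin ih a hs.left, bounded_obs_of_child hfin ih b hs.right⟩
termination_by s => sizeOf s
decreasing_by all_goals (subst_vars; simp; try omega)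

/-- A König argument. The induction must cover all descendants, since observing a constructor
descends into arguments, which are not reducts. -/
theorem SN.bounded_obs (hfin : ∀ t : ETm F, {u | Step R t u}.Finite) {t : ETm F} (h : SN R t) :
    (obs R t).Bounded := by
  have : ∀ s, Child s t → (obs R s).Bounded :=
    h.induct fun t _ ih => bounded_obs_of_child hfin ih
  exact this t (.refl t)

end Observations

/-! ### Interpretation of types -/

section Interpretation

variable {F : Type*} {R : Set (Rule F)} {S : Signature F}

/-- The computable terms of a type. -/
def Ty.interp (R : Set (Rule F)) : Ty → (ℕ → Dom) → Set (ETm F)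
  | base p, θ => {t | SN R t ∧ obs R t ≤ p.den θ}
  | arr T U, θ => {t | ∀ u ∈ T.interp R θ, app t u ∈ U.interp R θ}
  | all T, θ => {t | ∀ d : Dom, t ∈ T.interp R (d.cons θ)}

theorem Ty.interp_subst (T : Ty) (s : ℕ → Pat) (θ : ℕ → Dom) :
    (T.subst s).interp R θ = T.interp R (fun a => (s a).den θ) := by
  induction T generalizing s θ with
  | base p => simp only [subst, interp, Pat.den_subst]
  | arr T U ihT ihU => simp only [subst, interp, ihT, ihU]
  | all T ih =>
    simp only [subst, interp, ih]
    have : ∀ d : Dom, (fun a => (up s a).den (d.cons θ)) = d.cons (fun a => (s a).den θ) := by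
      intro d
      funext a
      cases a with
      | zero => rfl
      | succ a => simp only [up, Pat.den_lift]; rfl
    simp only [this]

theorem Ty.interp_shift (T : Ty) (d : Dom) (θ : ℕ → Dom) :
    T.shift.interp R (d.cons θ) = T.interp R θ :=
  T.interp_subst _ _

theorem Ty.interp_inst (T : Ty) (p : Pat) (θ : ℕ → Dom) :
    (T.inst p).interp R θ = T.interp R ((p.den θ).cons θ) := by
  rw [inst, interp_subst]
  congr 1
  funext a
  cases a <;> rfl

theorem Ty.Sub.interp {T U : Ty} (h : T.Sub U) (θ : ℕ → Dom) :
    T.interp R θ ⊆ U.interp R θ := by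
  induction h generalizing θ with
  | base h => exact fun t ht => ⟨ht.1, ht.2.trans (h.den θ)⟩
  | arr _ _ ih₁ ih₂ => exact fun t ht u hu => ih₂ θ (ht u (ih₁ θ hu))
  | all _ ih => exact fun t ht d => ih _ (ht d)

theorem Ty.interp_mono {T : Ty} {θ θ' : ℕ → Dom} (h₁ : ∀ a, T.Appears true a → θ a ≤ θ' a)
    (h₂ : ∀ a, T.Appears false a → θ' a ≤ θ a) : T.interp R θ ⊆ T.interp R θ' := by
  induction T generalizing θ θ' with
  | base p => exact fun t ht => ⟨ht.1, ht.2.trans (Pat.den_mono fun a ha => h₁ a ⟨rfl, ha⟩)⟩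
  | arr T U ihT ihU =>
    exact fun t ht u hu => ihU (fun a ha => h₁ a (.inr ha)) (fun a ha => h₂ a (.inr ha))
      (ht u (ihT (fun a ha => h₂ a (.inl ha)) (fun a ha => h₁ a (.inl ha)) hu))
  | all T ih =>
    refine fun t ht d => ih (fun a ha => ?_) (fun a ha => ?_) (ht d)
    · cases a with
      | zero => exact le_rfl
      | succ a => exact h₁ a ha
    · cases a with
      | zero => exact le_rfl
      | succ a => exact h₂ a ha

/-- Reducibility candidates. -/
structure IsCand (S : Signature F) (R : Set (Rule F)) (X : Set (ETm F)) : Prop where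
  sn : ∀ t ∈ X, SN R t
  step : ∀ t ∈ X, ∀ u, Step R t u → u ∈ X
  neutral : ∀ t, ¬ IsValue S t → (∀ u, Step R t u → u ∈ X) → t ∈ X

theorem IsCand.var_mem {X : Set (ETm F)} (h : IsCand S R X) (x : ℕ) : var x ∈ X :=
  h.neutral _ (not_isValue_var S x) fun _ hu => hu.var_false.elim

/-- Observations suit candidates: they only shrink under reduction, and a neutral term shows nothing
nontrivial before it has made a step. -/
theorem isCand_interp (hR : ∀ r ∈ R, r.IsRewriteRule S) (T : Ty) (θ : ℕ → Dom) :
    IsCand S R (T.interp R θ) := by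
  induction T generalizing θ with
  | base p =>
    refine ⟨fun t ht => ht.1, fun t ht u hu => ⟨ht.1.step hu, (obs_step hu).trans ht.2⟩,
      fun t hn ht => ⟨⟨t, fun u hu => (ht u hu).1⟩, fun o ho => ?_⟩⟩
    change HasObs R t o at ho
    cases ho with
    | bot => exact (p.den θ).2
    | leaf => exact (hn .leaf).elim
    | node _ _ => exact (hn (.node₂ _ _)).elim
    | step h ho => exact (ht _ h).2 ho
  | arr T U ihT ihU =>
    refine ⟨fun t ht => ((ihU θ).sn _ (ht _ ((ihT θ).var_mem 0))).app_left,
      fun t ht v hv u hu => (ihU θ).step _ (ht u hu) _ (.app_left u hv), fun t hn ht u hu => ?_⟩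
    -- A step of `app t u` may occur in `u`, so the neutral case needs an induction on the
    -- reductions of the argument.
    have hsn := (ihT θ).sn u hu
    induction hsn with
    | intro u _ ih =>
      refine (ihU θ).neutral _ (fun h => hn h.of_app) fun v hv => ?_
      rcases hv.of_neutral_app hR hn with ⟨t', rfl, ht'⟩ | ⟨u', rfl, hu'⟩
      · exact ht t' ht' u hu
      · exact ih u' hu' ((ihT θ).step _ hu _ hu')
  | all T ih =>
    exact ⟨fun t ht => (ih _).sn t (ht Dom.bot), fun t ht u hu d => (ih _).step t (ht d) u hu,
      fun t hn ht d => (ih _).neutral t hn fun u hu => ht u hu d⟩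

theorem lam_mem_interp (hR : ∀ r ∈ R, r.IsRewriteRule S) {T U : Ty} {θ : ℕ → Dom} {t : ETm F}
    (h : ∀ u ∈ T.interp R θ, t.subst (single u) ∈ U.interp R θ) :
    lam t ∈ (Ty.arr T U).interp R θ := by
  have cT := isCand_interp hR T θ
  have cU := isCand_interp hR U θ
  intro u hu
  have ht : SN R t := (cU.sn _ (h _ (cT.var_mem 0))).of_subst
  have hsn := cT.sn u hu
  induction ht generalizing u with
  | intro t ht iht =>
    induction hsn with
    | intro u hsn ihu =>
      refine cU.neutral _ (fun hv => ?_) fun v hv => ?_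
      · generalize hs : app (lam t) u = s at hv
        cases hv with
        | part f us _ =>
          rcases apps_sym_cases hs.symm with ⟨_, h'⟩ | ⟨ws, w, rfl, h'⟩
          · cases h'
          · injection h' with h₁ _
            rcases apps_sym_cases h₁.symm with ⟨_, h'⟩ | ⟨_, _, _, h'⟩ <;> cases h'
        | _ => cases hs
      · rcases hv.of_app_lam with rfl | ⟨t', rfl, ht'⟩ | ⟨u', rfl, hu'⟩
        · exact h u hu
        · exact iht t' ht' (fun w hw => cU.step _ (h w hw) _ (ht'.subst _)) u hu ⟨u, hsn⟩
        · exact ihu u' hu' (cT.step _ hu _ hu')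

theorem leaf_mem_interp (θ : ℕ → Dom) : (leaf : ETm F) ∈ (Ty.base Pat.leaf).interp R θ :=
  ⟨⟨_, fun _ h => h.leaf_false.elim⟩, (obs_leaf θ).le⟩

theorem SN.node₂ {a b : ETm F} (ha : SN R a) (hb : SN R b) : SN R (app (app node a) b) := by
  induction ha generalizing b with
  | intro a ha iha =>
    induction hb with
    | intro b hb ihb =>
      refine ⟨_, fun v hv => ?_⟩
      rcases Step.of_node₂ hv with ⟨a', rfl, h⟩ | ⟨b', rfl, h⟩
      · exact iha a' h ⟨b, hb⟩
      · exact ihb b' h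

theorem node_mem_interp {a b : ETm F} {p q : Pat} {θ : ℕ → Dom}
    (ha : a ∈ (Ty.base p).interp R θ) (hb : b ∈ (Ty.base q).interp R θ) :
    app (app node a) b ∈ (Ty.base (Pat.node p q)).interp R θ := by
  refine ⟨ha.1.node₂ hb.1, fun o ho => ?_⟩
  rcases HasObs.of_node ho with rfl | ⟨o₁, h₁, o₂, h₂, rfl⟩
  · exact .inl rfl
  · exact .inr ⟨o₁, ha.2 h₁, o₂, hb.2 h₂, rfl⟩

end Interpretation

/-! ### Soundness of typing for the interpretation. -/

section Soundness

variable {F : Type*} {R : Set (Rule F)} {S : Signature F}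

/-- The substitution sends the variables of the context to computable terms. -/
def Models (R : Set (Rule F)) (Γ : Ctx) (θ : ℕ → Dom) (σ : ℕ → ETm F) : Prop :=
  ∀ x T, Γ[x]? = some T → σ x ∈ T.interp R θ

/-- All computable instances of the erased term are computable at all types of the term. -/
def Valid (S : Signature F) (R : Set (Rule F)) (θ : ℕ → Dom) (t : Tm F) : Prop :=
  ∀ Γ T σ, HasType S Γ t T → Models R Γ θ σ → t.erase.subst σ ∈ T.interp R θ

theorem Models.cons {Γ : Ctx} {θ : ℕ → Dom} {σ : ℕ → ETm F} (h : Models R Γ θ σ) {T : Ty}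
    {u : ETm F} (hu : u ∈ T.interp R θ) : Models R (T :: Γ) θ (scons u σ) := by
  intro x U hx
  cases x with
  | zero => cases hx; exact hu
  | succ x => exact h x U hx

theorem Models.shift {Γ : Ctx} {θ : ℕ → Dom} {σ : ℕ → ETm F} (h : Models R Γ θ σ) (d : Dom) :
    Models R (Γ.map Ty.shift) (d.cons θ) σ := by
  intro x U hx
  rw [List.getElem?_map, Option.map_eq_some_iff] at hx
  obtain ⟨T, hT, rfl⟩ := hx
  rw [Ty.interp_shift]
  exact h x T hT

/-- Here and in the next lemmas, the inner induction on the derivation only strips final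
subsumptions. Quantifying over all types in `Valid` lets the outer argument follow the term, where
the calls are located. -/
theorem valid_var (θ : ℕ → Dom) (x : ℕ) : Valid S R θ (Tm.var x) := by
  intro Γ T σ h hσ
  generalize ht : Tm.var x = t at h
  induction h with
  | ax hx => cases ht; exact hσ _ _ hx
  | sub _ hs ih => exact hs.interp θ (ih hσ ht)
  | _ => cases ht

theorem valid_leaf (θ : ℕ → Dom) : Valid S R θ Tm.leaf := by
  intro Γ T σ h hσ
  generalize ht : Tm.leaf = t at h
  induction h with
  | leaf_intro => exact leaf_mem_interp θ
  | sub _ hs ih => exact hs.interp θ (ih hσ ht)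
  | _ => cases ht

theorem valid_node (θ : ℕ → Dom) : Valid S R θ Tm.node := by
  intro Γ T σ h hσ
  generalize ht : Tm.node = t at h
  induction h with
  | node_intro => exact fun d₁ d₂ a ha b hb => node_mem_interp ha hb
  | sub _ hs ih => exact hs.interp θ (ih hσ ht)
  | _ => cases ht

theorem Valid.app {θ : ℕ → Dom} {t u : Tm F} (h₁ : Valid S R θ t) (h₂ : Valid S R θ u) :
    Valid S R θ (Tm.app t u) := by
  intro Γ T σ h hσ
  generalize hs : Tm.app t u = s at h
  induction h with
  | t_app ht hu => cases hs; exact h₁ _ _ σ ht hσ _ (h₂ _ _ σ hu hσ)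
  | sub _ hs' ih => exact hs'.interp θ (ih hσ hs)
  | _ => cases hs

theorem Valid.papp {θ : ℕ → Dom} {t : Tm F} (h₁ : Valid S R θ t) (p : Pat) :
    Valid S R θ (Tm.papp t p) := by
  intro Γ T σ h hσ
  generalize hs : Tm.papp t p = s at h
  induction h with
  | p_app p ht => cases hs; rw [Ty.interp_inst]; exact h₁ _ _ σ ht hσ _
  | sub _ hs' ih => exact hs'.interp θ (ih hσ hs)
  | _ => cases hs

theorem Valid.lam (hR : ∀ r ∈ R, r.IsRewriteRule S) {θ : ℕ → Dom} {t : Tm F}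
    (h₁ : Valid S R θ t) (U : Ty) : Valid S R θ (Tm.lam U t) := by
  intro Γ T σ h hσ
  generalize hs : Tm.lam U t = s at h
  induction h with
  | t_lam ht =>
    cases hs
    refine lam_mem_interp hR fun u hu => ?_
    rw [subst_up_single]
    exact h₁ _ _ _ ht (hσ.cons hu)
  | sub _ hs' ih => exact hs'.interp θ (ih hσ hs)
  | _ => cases hs

theorem Valid.plam {θ : ℕ → Dom} {t : Tm F} (h₁ : ∀ d : Dom, Valid S R (d.cons θ) t) :
    Valid S R θ (Tm.plam t) := by
  intro Γ T σ h hσ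
  generalize hs : Tm.plam t = s at h
  induction h with
  | p_lam ht => cases hs; exact fun d => h₁ d _ _ _ ht (hσ.shift d)
  | sub _ hs' ih => exact hs'.interp θ (ih hσ hs)
  | _ => cases hs

/-- The type `B(α₁) → … → B(αₖ) → T_f`. -/
def Signature.body (S : Signature F) (f : F) : Ty :=
  (List.range (S.nrec f)).foldr
    (fun i T => Ty.arr (Ty.base (Pat.var (S.npat f - 1 - i))) T) (S.res f)

/-- `T` has the form `∀ α₁ … αₘ. U` and `U` contains all computable terms of `X`, where the bound
variables have the same values in both types. -/
def Covers (R : Set (Rule F)) (X : Ty) : ℕ → Ty → (ℕ → Dom) → (ℕ → Dom) → Prop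
  | 0, T, θ, η => X.interp R η ⊆ T.interp R θ
  | m + 1, T, θ, η => ∃ U, T = Ty.all U ∧ ∀ d : Dom, Covers R X m U (d.cons θ) (d.cons η)

theorem covers_iterate_all (X : Ty) (m : ℕ) (θ : ℕ → Dom) :
    Covers R X m (Ty.all^[m] X) θ θ := by
  induction m generalizing θ with
  | zero => exact fun _ h => h
  | succ m ih => exact ⟨_, Function.iterate_succ_apply' .., fun d => ih _⟩

theorem Covers.sub {X T U : Ty} {m : ℕ} {θ η : ℕ → Dom} (h : Covers R X m T θ η)
    (hs : T.Sub U) : Covers R X m U θ η := by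
  induction m generalizing T U θ η with
  | zero => exact h.trans (hs.interp θ)
  | succ m ih =>
    obtain ⟨T', rfl, hT⟩ := h
    cases hs with
    | all hs => exact ⟨_, rfl, fun d => ih (hT d) hs⟩

theorem Covers.subst {X T : Ty} {m : ℕ} {θ η : ℕ → Dom} {s : ℕ → Pat}
    (h : Covers R X m T (fun a => (s a).den θ) η) : Covers R X m (T.subst s) θ η := by
  induction m generalizing T θ η s with
  | zero => intro t ht; rw [Ty.interp_subst]; exact h ht
  | succ m ih =>
    obtain ⟨U, rfl, hU⟩ := h
    refine ⟨U.subst (Ty.up s), rfl, fun d => ih ?_⟩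
    convert hU d using 1
    funext a
    cases a with
    | zero => rfl
    | succ a => simp only [Ty.up, Pat.den_lift]; rfl

theorem Ty.den_instList_concat (qs : List Pat) (q : Pat) (θ : ℕ → Dom) :
    (fun a => (instList (qs ++ [q]) a).den θ) =
      (q.den θ).cons (fun a => (instList qs a).den θ) := by
  funext a
  cases a with
  | zero => simp [instList, Dom.cons]
  | succ a => simp [instList, Dom.cons]

/-- Subsumption may come between pattern applications, so the type of a partial call need not be an
instance of `τ_g`. `Covers` keeps the semantic inclusion together with the remaining quantifier
prefix, and both survive subsumption and instantiation. -/
theorem covers_of_hasType {g : F} {qs : List Pat} {m : ℕ} (hm : qs.length + m = S.npat g)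
    {Γ : Ctx} {T : Ty} (h : HasType S Γ ((Tm.sym g).papps qs) T) (θ : ℕ → Dom) :
    Covers R (S.body g) m T θ (fun a => (Ty.instList qs a).den θ) := by
  induction qs using List.reverseRecOn generalizing m T Γ with
  | nil =>
    obtain rfl : m = S.npat g := by simpa using hm
    generalize ht : (Tm.sym g).papps [] = t at h
    induction h with
    | symb f => cases ht; exact covers_iterate_all _ _ _
    | sub _ hs ih => exact (ih ht).sub hs
    | _ => cases ht
  | append_singleton qs q ihq =>
    have e : (Tm.sym g).papps (qs ++ [q]) = ((Tm.sym g).papps qs).papp q := by simp [Tm.papps]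
    rw [e] at h
    rw [Ty.den_instList_concat]
    generalize ht : ((Tm.sym g).papps qs).papp q = t at h
    induction h with
    | p_app p h =>
      cases ht
      obtain ⟨U, hU, hc⟩ := ihq (m := m + 1) (by simp at hm; omega) h
      cases hU
      refine Covers.subst ?_
      convert hc (q.den θ) using 1
      exact Ty.den_instList_concat [] q θ
    | sub _ hs ih => exact (ih ht).sub hs
    | _ => cases ht

/-- The symbol `g` is computable when its pattern arguments are `qs`. -/
def Callable (S : Signature F) (R : Set (Rule F)) (η : ℕ → Dom) (g : F) (qs : List Pat) : Prop :=
  sym g ∈ (S.body g).interp R (fun a => (Ty.instList qs a).den η)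

theorem Callable.valid {η : ℕ → Dom} {g : F} {qs : List Pat} (h : Callable S R η g qs)
    (hl : qs.length = S.npat g) : Valid S R η ((Tm.sym g).papps qs) := by
  intro Γ T σ ht _
  rw [Tm.erase_papps]
  exact covers_of_hasType (m := 0) hl ht η h

theorem mem_interp_iterate_all {X : Ty} {t : ETm F} (h : ∀ η : ℕ → Dom, t ∈ X.interp R η)
    (m : ℕ) (θ : ℕ → Dom) : t ∈ (Ty.all^[m] X).interp R θ := by
  induction m generalizing θ with
  | zero => exact h θ
  | succ m ih =>
    rw [Function.iterate_succ_apply']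
    exact fun d => ih _

theorem valid_sym {θ : ℕ → Dom} {g : F}
    (h : ∀ η : ℕ → Dom, sym g ∈ (S.body g).interp R η) : Valid S R θ (Tm.sym g) := by
  intro Γ T σ ht hσ
  generalize hs : Tm.sym g = t at ht
  induction ht with
  | symb f => cases hs; exact mem_interp_iterate_all h _ θ
  | sub _ hs' ih => exact hs'.interp θ (ih hσ hs)
  | _ => cases hs

theorem valid_of_sym (hR : ∀ r ∈ R, r.IsRewriteRule S)
    (h : ∀ (g : F) (η : ℕ → Dom), sym g ∈ (S.body g).interp R η) (t : Tm F) (θ : ℕ → Dom) :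
    Valid S R θ t := by
  induction t generalizing θ with
  | var x => exact valid_var θ x
  | sym f => exact valid_sym (h f)
  | app t u iht ihu => exact (iht θ).app (ihu θ)
  | papp t p ih => exact (ih θ).papp p
  | lam T t ih => exact (ih θ).lam hR T
  | plam t ih => exact .plam fun d => ih _
  | node => exact valid_node θ
  | leaf => exact valid_leaf θ

/-- Because calls carry all their pattern arguments, a symbol need only be computable at the
denotations of those arguments, not at every valuation. The valuations `η` extend `θ` by arbitrary
values for the `d` binders crossed. -/
theorem Tm.FullyApplied.valid (hR : ∀ r ∈ R, r.IsRewriteRule S) {t : Tm F}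
    (ht : t.FullyApplied S) {θ : ℕ → Dom}
    (h : ∀ d g qs, qs.length = S.npat g → ((Tm.sym g).papps qs).OccursIn d t →
      ∀ η : ℕ → Dom, (∀ a, η (a + d) = θ a) → Callable S R η g qs) : Valid S R θ t := by
  induction ht generalizing θ with
  | call g qs hl => exact (h 0 g qs hl .here θ fun _ => rfl).valid hl
  | var x => exact valid_var θ x
  | app _ _ iht ihu =>
    exact (iht fun d g qs hl ho => h d g qs hl (.app_left _ ho)).app
      (ihu fun d g qs hl ho => h d g qs hl (.app_right _ ho))
  | papp p _ ih => exact (ih fun d g qs hl ho => h d g qs hl (.papp _ ho)).papp p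
  | lam T _ ih => exact (ih fun d g qs hl ho => h d g qs hl (.lam _ ho)).lam hR T
  | plam _ ih =>
    exact .plam fun d₀ => ih fun d g qs hl ho η hη =>
      h (d + 1) g qs hl (.plam ho) η fun a =>
        (congrArg η (by omega)).trans (hη (a + 1))
  | node => exact valid_node θ
  | leaf => exact valid_leaf θ

/-! ### Function symbols -/

/-- The pattern is built from variables and constructors only. -/
def Pat.Plain : Pat → Prop
  | var _ => True
  | leaf => True
  | node p q => p.Plain ∧ q.Plain
  | wild => False
  | bot => False

theorem CTm.MinType.plain {Γ : Ctx} {l : CTm} {p : Pat} (h : l.MinType Γ p) : p.Plain := by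
  induction h with
  | var => trivial
  | leaf => trivial
  | node _ _ ih₁ ih₂ => exact ⟨ih₁, ih₂⟩

theorem CTm.MinType.exists_of_mem_fv {Γ : Ctx} {l : CTm} {p : Pat} (h : l.MinType Γ p) {x : ℕ}
    (hx : x ∈ (l.toTm F).fv) : ∃ a, Γ[x]? = some (Ty.base (Pat.var a)) ∧
      ∀ y T, y ≠ x → Γ[y]? = some T → ¬ T.Free a := by
  induction h with
  | var h₁ h₂ => cases hx; exact ⟨_, h₁, h₂⟩
  | leaf => cases hx
  | node _ _ ih₁ ih₂ =>
    simp only [toTm, Tm.fv, Set.empty_union] at hx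
    exact hx.elim ih₁ ih₂

theorem CTm.MinType.exists_of_occurs {Γ : Ctx} {l : CTm} {p : Pat} (h : l.MinType Γ p) {a : ℕ}
    (ha : p.Occurs a) : ∃ x ∈ (l.toTm F).fv, Γ[x]? = some (Ty.base (Pat.var a)) := by
  induction h with
  | var h₁ h₂ => cases ha; exact ⟨_, rfl, h₁⟩
  | leaf => cases ha
  | node _ _ ih₁ ih₂ =>
    simp only [toTm, Tm.fv, Set.empty_union]
    rcases ha with ha | ha
    · obtain ⟨x, hx, h⟩ := ih₁ ha; exact ⟨x, .inl hx, h⟩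
    · obtain ⟨x, hx, h⟩ := ih₂ ha; exact ⟨x, .inr hx, h⟩

/-- The pattern of a minimally typed term mirrors its constructors, with a pattern variable exactly
where the term has a variable. -/
theorem CTm.MinType.obs_eq {Γ : Ctx} {l : CTm} {p : Pat} (h : l.MinType Γ p) {θ : ℕ → Dom}
    {s : ℕ → ETm F} (hθ : ∀ x ∈ (l.toTm F).fv, ∀ a, Γ[x]? = some (Ty.base (Pat.var a)) →
      θ a = obs R (s x)) : obs R ((l.toTm F).erase.subst s) = p.den θ := by
  induction h with
  | var h₁ h₂ => exact (hθ _ rfl _ h₁).symm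
  | leaf => exact obs_leaf θ
  | node _ _ ih₁ ih₂ =>
    simp only [toTm, Tm.fv, Set.empty_union] at hθ
    exact obs_node (ih₁ fun x hx => hθ x (.inl hx)) (ih₂ fun x hx => hθ x (.inr hx))

theorem CTm.sn_of_mem_fv {l : CTm} {s : ℕ → ETm F} (h : SN R ((l.toTm F).erase.subst s)) {x : ℕ}
    (hx : x ∈ (l.toTm F).fv) : SN R (s x) := by
  induction l with
  | var y => cases hx; exact h
  | leaf => cases hx
  | node p q l₁ l₂ ih₁ ih₂ =>
    simp only [toTm, Tm.fv, Set.empty_union] at hx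
    exact hx.elim (ih₁ h.app_left.app_right) (ih₂ h.app_right)

theorem Ty.Appears.free {pos : Bool} {a : ℕ} {T : Ty} (h : T.Appears pos a) : T.Free a := by
  induction T generalizing pos a with
  | base p => exact h.2
  | arr T U ihT ihU => exact h.imp ihT ihU
  | all T ih => exact ih h

theorem Ty.instList_rev {ps : List Pat} {i : ℕ} (hi : i < ps.length) :
    instList ps (ps.length - 1 - i) = ps[i] := by
  have : ps.length - 1 - i < ps.reverse.length := by simp; omega
  simp only [instList, List.getD_eq_getElem _ _ this, List.getElem_reverse]
  congr 1
  omega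

theorem mem_interp_foldr_arr {is : List ℕ} {A : ℕ → Ty} {U : Ty} {θ : ℕ → Dom} {t : ETm F}
    (h : ∀ us, List.Forall₂ (fun i u => u ∈ (A i).interp R θ) is us →
      t.apps us ∈ U.interp R θ) :
    t ∈ (is.foldr (fun i T => Ty.arr (A i) T) U).interp R θ := by
  induction is generalizing t with
  | nil => exact h [] .nil
  | cons i is ih => exact fun u hu => ih fun us hus => h (u :: us) (.cons hu hus)

/-- A valuation of the variables of a rule that matches computable arguments: it gives the arguments
of the left-hand side observations below those of `η`. -/
structure Matches (S : Signature F) (r : Rule F) (η θ : ℕ → Dom) : Prop where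
  plain : ∀ p ∈ r.pats.take (S.nrec r.head), p.Plain
  bounded : ∀ p ∈ r.pats.take (S.nrec r.head), ∀ a, p.Occurs a → (θ a).Bounded
  den_le : ∀ i p, i < S.nrec r.head → r.pats[i]? = some p →
    p.den θ ≤ η (S.npat r.head - 1 - i)

-- The valuation `θ` is read off from the matching substitution, the right-hand side is computable
-- at `T_f` instantiated through `θ`, and monotonicity moves the result to `η`: recursive positions
-- only grow, and the others are unchanged.
open Classical in
theorem Rule.WellTyped.rhs_mem (hfin : R.Finite) (hR : ∀ r ∈ R, r.IsRewriteRule S) {r : Rule F}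
    (hr : r ∈ R) (hwt : r.WellTyped S) {η : ℕ → Dom}
    (H : ∀ θ, Matches S r η θ → Valid S R θ r.rhs) {s : ℕ → ETm F}
    (hs : List.Forall₂ (fun i u => u ∈ (Ty.base (Pat.var (S.npat r.head - 1 - i))).interp R η)
      (List.range (S.nrec r.head)) (r.args.map fun l => (l.toTm F).erase.subst s)) :
    r.rhs.erase.subst s ∈ (S.res r.head).interp R η := by
  obtain ⟨Γ, T, ⟨hargs, ⟨bs, hbs, hnd, hfree⟩, rfl⟩, hT⟩ := hwt
  have hpl := (hR r hr).pats_length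
  have hal := (hR r hr).args_length
  have hle := S.nrec_le r.head
  set k := S.nrec r.head with hk
  set n := S.npat r.head with hn
  rw [List.forall₂_iff_get] at hargs hs
  have hmin : ∀ i (hi : i < k), (r.args[i]).MinType Γ (r.pats[i]) := fun i hi => by
    simpa using hargs.2 i (by omega) (by simp; omega)
  have harg : ∀ i (hi : i < k), (((r.args[i]).toTm F).erase.subst s) ∈
      (Ty.base (Pat.var (n - 1 - i))).interp R η := fun i hi => by
    simpa using hs.2 i (by simpa using hi) (by simp; omega)
  have hlhs : ∀ x, x ∈ r.lhs.fv ↔ ∃ i, ∃ hi : i < k, x ∈ ((r.args[i]).toTm F).fv := fun x => by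
    rw [Rule.mem_fv_lhs]
    constructor
    · rintro ⟨l, hl, hx⟩
      obtain ⟨i, hi, rfl⟩ := List.getElem_of_mem hl
      exact ⟨i, by omega, hx⟩
    · rintro ⟨i, hi, hx⟩
      exact ⟨_, List.getElem_mem _, hx⟩
  -- Variables of constructor arguments receive exact observations. The `βⱼ` receive the values that
  -- `η` prescribes: the entry of `bs` with index `j` is the pattern argument at position `k + j`,
  -- hence de Bruijn index `n - 1 - (k + j)`. The default is arbitrary.
  let θ : ℕ → Dom := fun a =>
    if h : ∃ x ∈ r.lhs.fv, Γ[x]? = some (Ty.base (Pat.var a)) then obs R (s h.choose)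
    else if a ∈ bs then η (n - 1 - (k + bs.idxOf a)) else Dom.bot
  have hθ : ∀ x ∈ r.lhs.fv, ∀ a, Γ[x]? = some (Ty.base (Pat.var a)) → θ a = obs R (s x) := by
    intro x hx a ha
    have hex : ∃ x ∈ r.lhs.fv, Γ[x]? = some (Ty.base (Pat.var a)) := ⟨x, hx, ha⟩
    -- By the freshness condition in minimal typing, no two context variables share this pattern
    -- variable, so the choice is forced.
    have : hex.choose = x := by
      obtain ⟨i, hi, hxi⟩ := (hlhs x).1 hx
      obtain ⟨b, hb, hu⟩ := (hmin i hi).exists_of_mem_fv hxi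
      rw [ha] at hb
      cases hb
      by_contra hne
      exact hu _ _ hne hex.choose_spec.2 rfl
    simp only [θ, dif_pos hex, this]
  have hsn : ∀ x ∈ r.lhs.fv, SN R (s x) := fun x hx => by
    obtain ⟨i, hi, hxi⟩ := (hlhs x).1 hx
    exact CTm.sn_of_mem_fv (harg i hi).1 hxi
  have hobs : ∀ i (hi : i < k), obs R (((r.args[i]).toTm F).erase.subst s) = (r.pats[i]).den θ :=
    fun i hi => (hmin i hi).obs_eq fun x hx => hθ x ((hlhs x).2 ⟨i, hi, hx⟩)
  have hmem : ∀ p ∈ r.pats.take k, ∃ i, ∃ hi : i < k, p = r.pats[i] := fun p hp => by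
    obtain ⟨i, hi, rfl⟩ := List.getElem_of_mem hp
    exact ⟨i, by simp at hi; omega, by simp⟩
  have hmatch : Matches S r η θ := by
    refine ⟨fun p hp => ?_, fun p hp a ha => ?_, fun i p hi hp => ?_⟩
    · obtain ⟨i, hi, rfl⟩ := hmem p hp
      exact (hmin i hi).plain
    · obtain ⟨i, hi, rfl⟩ := hmem p hp
      obtain ⟨x, hx, hax⟩ := (hmin i hi).exists_of_occurs (F := F) ha
      have hx' := (hlhs x).2 ⟨i, hi, hx⟩
      rw [hθ x hx' a hax]
      exact (hsn x hx').bounded_obs (finite_step hfin hR)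
    · obtain ⟨_, rfl⟩ := List.getElem?_eq_some_iff.1 hp
      rw [← hobs i hi]
      exact (harg i hi).2
  -- Nothing is known about `s` outside the left-hand side, whereas a variable lies in every
  -- candidate; the right-hand side cannot see the difference.
  let σ : ℕ → ETm F := fun x => if x ∈ r.lhs.fv then s x else var x
  have hσ : Models R Γ θ σ := by
    intro x U hx
    by_cases hxl : x ∈ r.lhs.fv
    · simp only [σ, if_pos hxl]
      obtain ⟨i, hi, hxi⟩ := (hlhs x).1 hxl
      obtain ⟨b, hb, hu⟩ := (hmin i hi).exists_of_mem_fv hxi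
      rw [hx] at hb
      cases hb
      exact ⟨hsn x hxl, (hθ x hxl b hx).ge⟩
    · simp only [σ, if_neg hxl]
      exact (isCand_interp hR U θ).var_mem x
  have hmain := H θ hmatch Γ _ σ hT hσ
  rw [Tm.erase_subst_congr (s' := s) fun x hx => if_pos ((hR r hr).fv_subset hx),
    Ty.interp_subst] at hmain
  -- Equality is needed here, since the non-recursive pattern variables may also appear negatively
  -- in `T_f`.
  have hrest : ∀ i, k ≤ i → ∀ hi : i < n, (r.pats[i]).den θ = η (n - 1 - i) := by
    intro i hki hi
    have hlen : bs.length = n - k := by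
      have := congrArg List.length hbs
      simp at this; omega
    have hib : i - k < bs.length := by omega
    have hp : r.pats[i] = Pat.var bs[i - k] := by
      have h1 : (r.pats.drop k)[i - k]? = (bs.map Pat.var)[i - k]? := by rw [hbs]
      rw [List.getElem?_drop, Nat.add_sub_cancel' hki, List.getElem?_eq_getElem (by omega),
        List.getElem?_map, List.getElem?_eq_getElem hib] at h1
      exact Option.some.inj h1
    have hbm : bs[i - k] ∈ bs := List.getElem_mem _
    have hno : ¬ ∃ x ∈ r.lhs.fv, Γ[x]? = some (Ty.base (Pat.var bs[i - k])) := by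
      rintro ⟨x, _, hx⟩
      exact hfree _ hbm _ (List.mem_of_getElem? hx) rfl
    rw [hp]
    change θ _ = _
    simp only [θ, dif_neg hno, if_pos hbm, hnd.idxOf_getElem]
    congr 1
    omega
  have key : ∀ a, a < n → ∃ i, ∃ hi : i < n, a = n - 1 - i ∧ Ty.instList r.pats a = r.pats[i] :=
    fun a ha => ⟨n - 1 - a, by omega, by omega, by
      rw [← Ty.instList_rev (by omega)]; congr 1; omega⟩
  refine Ty.interp_mono (fun a ha => ?_) (fun a ha => ?_) hmain
  · obtain ⟨i, hi, rfl, hia⟩ := key a (S.closed _ _ ha.free)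
    simp only [hia]
    by_cases hik : i < k
    · exact hmatch.den_le i _ hik (List.getElem?_eq_getElem _)
    · exact (hrest i (by omega) hi).le
  · obtain ⟨i, hi, rfl, hia⟩ := key a (S.closed _ _ ha.free)
    simp only [hia]
    by_cases hik : i < k
    · exact (S.positive _ i hik ha).elim
    · exact (hrest i (by omega) hi).ge

/-- The complete call is neutral, so its reducts decide: a step in an argument is handled by
induction on `ListStep`, a root rewrite by `Rule.WellTyped.rhs_mem`. -/
theorem sym_mem_interp_body (hfin : R.Finite) (hR : ∀ r ∈ R, r.IsRewriteRule S)
    (hwt : ∀ r ∈ R, r.WellTyped S) {f : F} {η : ℕ → Dom}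
    (H : ∀ r ∈ R, r.head = f → ∀ θ, Matches S r η θ → Valid S R θ r.rhs) :
    sym f ∈ (S.body f).interp R η := by
  refine mem_interp_foldr_arr fun us hus => ?_
  have hacc : Acc (fun a b => ListStep R b a) us := by
    refine acc_listStep fun u hu => ?_
    obtain ⟨i, hi, rfl⟩ := List.getElem_of_mem hu
    rw [List.forall₂_iff_get] at hus
    exact (hus.2 i (by omega) hi).1
  induction hacc with
  | intro us _ ih =>
    have hl : us.length = S.nrec f := by simpa using hus.length_eq.symm
    refine (isCand_interp hR _ _).neutral _ (not_isValue_apps hl) fun v hv => ?_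
    rcases hv.of_apps_sym hR hl.le with ⟨r, hr, s, hs, rfl⟩ | ⟨us', rfl, hs⟩
    · rw [r.erase_lhs_subst] at hs
      obtain ⟨rfl, rfl⟩ := apps_sym_inj hs
      exact (hwt r hr).rhs_mem hfin hR hr (H r hr rfl) hus
    · exact ih us' hs (hs.forall₂
        (P := fun i u => u ∈ (Ty.base (Pat.var (S.npat f - 1 - i))).interp R η)
        (fun i t u ht hu => (isCand_interp hR _ _).step t ht u hu) hus)

end Soundness

/-! ### Unifiability -/

namespace Pat

theorem le_freshen (p : Pat) (c : ℕ) : c ≤ (p.freshen c).2 := by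
  induction p generalizing c with
  | node p q ihp ihq => exact (ihp c).trans (ihq _)
  | var a => exact Nat.le_succ c
  | wild => exact Nat.le_succ c
  | _ => exact le_rfl

theorem Occurs.freshen {p : Pat} {c a : ℕ} (h : (p.freshen c).1.Occurs a) :
    c ≤ a ∧ a < (p.freshen c).2 := by
  induction p generalizing c with
  | node p q ihp ihq =>
    have h₁ := p.le_freshen c
    have h₂ := q.le_freshen (p.freshen c).2
    rcases h with h | h
    · exact ⟨(ihp h).1, (ihp h).2.trans_le h₂⟩
    · exact ⟨h₁.trans (ihq h).1, (ihq h).2⟩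
  | var b => cases h; exact ⟨le_rfl, Nat.lt_succ_self _⟩
  | wild => cases h; exact ⟨le_rfl, Nat.lt_succ_self _⟩
  | leaf => cases h
  | bot => cases h

theorem subst_congr {p : Pat} {s s' : ℕ → Pat} (h : ∀ a, p.Occurs a → s a = s' a) :
    p.subst s = p.subst s' := by
  induction p with
  | var a => exact h a rfl
  | node p q ihp ihq =>
    simp only [subst]
    rw [ihp fun a ha => h a (.inl ha), ihq fun a ha => h a (.inr ha)]
  | _ => rfl

theorem subst_var (p : Pat) : p.subst var = p := by
  induction p with
  | node p q ihp ihq => simp only [subst, ihp, ihq]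
  | _ => rfl

theorem subst_update_of_not_occurs {p : Pat} {c : ℕ} (h : ¬ p.Occurs c) (q : Pat) :
    p.subst (Function.update var c q) = p := by
  refine (subst_congr fun a ha => ?_).trans p.subst_var
  rw [Function.update_of_ne]
  rintro rfl
  exact h ha

/-- After freshening both patterns are linear with disjoint variables, so only a clash of
constructors could prevent unification. The observation of the root constructor of `p` rules that
out. Plainness excludes `⊥`, which lies below every pattern but unifies with few. -/
theorem exists_unifier {p q : Pat} {θ θ' : ℕ → Dom} (hp : p.Plain) (h : p.den θ' ≤ q.den θ)
    {c c' : ℕ} (hc : (q.freshen c).2 ≤ c') :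
    ∃ s, (q.freshen c).1.subst s = (p.freshen c').1.subst s := by
  have hvar : ∀ x, (x = var c ∧ c < c') → ∃ s, x.subst s = (p.freshen c').1.subst s := by
    rintro _ ⟨rfl, hlt⟩
    refine ⟨Function.update var c (p.freshen c').1, ?_⟩
    rw [subst_update_of_not_occurs fun ho => absurd ho.freshen.1 (by omega)]
    exact Function.update_self ..
  have hvar' : ∃ s, (q.freshen c).1.subst s = (var c').subst s := by
    refine ⟨Function.update var c' (q.freshen c).1, ?_⟩
    rw [subst_update_of_not_occurs fun ho => absurd ho.freshen.2 (by omega)]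
    exact (Function.update_self (f := var) ..).symm
  have leaf_mem : Obs.leaf ∈ (leaf.den θ').1 := .inr rfl
  have node_mem : ∀ p₁ p₂ : Pat, Obs.node .bot .bot ∈ ((node p₁ p₂).den θ').1 := fun p₁ p₂ =>
    .inr ⟨_, (p₁.den θ').2, _, (p₂.den θ').2, rfl⟩
  cases q with
  | var a => exact hvar _ ⟨rfl, hc⟩
  | wild => exact hvar _ ⟨rfl, hc⟩
  | leaf =>
    cases p with
    | var a => exact hvar'
    | leaf => exact ⟨var, rfl⟩
    | node p₁ p₂ => rcases h (node_mem p₁ p₂) with h | h <;> cases h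
    | wild => exact hp.elim
    | bot => exact hp.elim
  | bot =>
    cases p with
    | var a => exact hvar'
    | leaf => cases h leaf_mem
    | node p₁ p₂ => cases h (node_mem p₁ p₂)
    | wild => exact hp.elim
    | bot => exact hp.elim
  | node q₁ q₂ =>
    cases p with
    | var a => exact hvar'
    | leaf => rcases h leaf_mem with h | ⟨_, _, _, _, h⟩ <;> cases h
    | node p₁ p₂ =>
      -- Pairing `o` with any observation of the sibling, here the trivial one, projects the
      -- inclusion to a component.
      have h₁ : p₁.den θ' ≤ q₁.den θ := fun o ho => by
        rcases h (.inr ⟨o, ho, _, (p₂.den θ').2, rfl⟩) with h | ⟨_, h₁, _, _, h⟩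
        · cases h
        · cases h; exact h₁
      have h₂ : p₂.den θ' ≤ q₂.den θ := fun o ho => by
        rcases h (.inr ⟨_, (p₁.den θ').2, o, ho, rfl⟩) with h | ⟨_, _, _, h₂, h⟩
        · cases h
        · cases h; exact h₂
      have hq₁ := q₁.le_freshen c
      have hq₂ := q₂.le_freshen (q₁.freshen c).2
      have hp₁ := p₁.le_freshen c'
      have hc₂ : (q₂.freshen (q₁.freshen c).2).2 ≤ c' := hc
      obtain ⟨s₁, hs₁⟩ := exists_unifier (c := c) (c' := c') hp.1 h₁ (hq₂.trans hc₂)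
      obtain ⟨s₂, hs₂⟩ := exists_unifier (c := (q₁.freshen c).2) (c' := (p₁.freshen c').2) hp.2 h₂
        (hc₂.trans hp₁)
      -- The two unifiers can be glued because freshening gives the left and right components
      -- disjoint intervals of names.
      let s : ℕ → Pat := fun a =>
        if a < (q₁.freshen c).2 ∨ c' ≤ a ∧ a < (p₁.freshen c').2 then s₁ a else s₂ a
      refine ⟨s, ?_⟩
      simp only [freshen, subst, node.injEq]
      constructor
      · rw [subst_congr (s' := s₁) fun a ha => if_pos (.inl ha.freshen.2),
          subst_congr (p := (p₁.freshen c').1) (s' := s₁) fun a ha => if_pos (.inr ha.freshen), hs₁]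
      · rw [subst_congr (s' := s₂) fun a ha => if_neg ?_,
          subst_congr (p := (p₂.freshen _).1) (s' := s₂) fun a ha => if_neg ?_, hs₂]
        · have := ha.freshen
          omega
        · have := ha.freshen
          omega
    | wild => exact hp.elim
    | bot => exact hp.elim

theorem unifiable_of_den_le {p q : Pat} {θ θ' : ℕ → Dom} (hp : p.Plain)
    (h : p.den θ' ≤ q.den θ) : q.Unifiable p :=
  exists_unifier hp h le_rfl

/-! ### The size of patterns -/

theorem Plain.noWild {p : Pat} (h : p.Plain) : p.NoWild := by
  induction p with
  | node p q ihp ihq => exact ⟨ihp h.1, ihq h.2⟩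
  | wild => exact h
  | _ => trivial

theorem Plain.lift {p : Pat} (h : p.Plain) (d : ℕ) : (p.lift d).Plain := by
  induction p with
  | node p q ihp ihq => exact ⟨ihp h.1, ihq h.2⟩
  | _ => exact h

theorem Occurs.of_lift {p : Pat} {d a : ℕ} (h : (p.lift d).Occurs a) :
    ∃ b, p.Occurs b ∧ a = b + d := by
  induction p with
  | var b => exact ⟨b, rfl, h⟩
  | node p q ihp ihq =>
    rcases h with h | h
    · obtain ⟨b, hb, e⟩ := ihp h; exact ⟨b, .inl hb, e⟩
    · obtain ⟨b, hb, e⟩ := ihq h; exact ⟨b, .inr hb, e⟩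
  | _ => cases h

/-- The maximal size of the observations allowed by a pattern without wildcards under a bounded
valuation. -/
noncomputable def meas (θ : ℕ → Dom) : Pat → ℕ
  | var a => sSup (Obs.size '' (θ a).1)
  | leaf => 0
  | node p q => p.meas θ + q.meas θ + 1
  | wild => 0
  | bot => 0

theorem PreEmb.meas_lt {p q : Pat} (h : p.PreEmb q) (θ : ℕ → Dom) : q.meas θ < p.meas θ := by
  induction h <;> simp only [meas] at * <;> omega

theorem PreEmb.occurs {p q : Pat} (h : p.PreEmb q) {a : ℕ} (ha : q.Occurs a) : p.Occurs a := by
  induction h <;> simp only [Occurs] at * <;> tauto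

/-- The measure is an attained maximum; attainment lets inclusions of denotations compare measures.
A wildcard would allow observations of unbounded size. -/
theorem meas_spec {p : Pat} {θ : ℕ → Dom} (hp : p.NoWild)
    (hb : ∀ a, p.Occurs a → (θ a).Bounded) :
    (∀ o ∈ (p.den θ).1, o.size ≤ p.meas θ) ∧ ∃ o ∈ (p.den θ).1, o.size = p.meas θ := by
  induction p with
  | var a =>
    obtain ⟨N, hN⟩ := hb a rfl
    have hbdd : BddAbove (Obs.size '' (θ a).1) := ⟨N, by rintro _ ⟨o, ho, rfl⟩; exact hN o ho⟩
    exact ⟨fun o ho => le_csSup hbdd ⟨o, ho, rfl⟩,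
      Nat.sSup_mem ((Set.nonempty_of_mem (θ a).2).image Obs.size) hbdd⟩
  | leaf =>
    refine ⟨?_, Obs.bot, .inl rfl, rfl⟩
    rintro _ (rfl | rfl) <;> exact le_rfl
  | bot => exact ⟨by rintro _ rfl; exact le_rfl, Obs.bot, rfl, rfl⟩
  | wild => exact hp.elim
  | node p q ihp ihq =>
    obtain ⟨hp₁, o₁, ho₁, e₁⟩ := ihp hp.1 fun a ha => hb a (.inl ha)
    obtain ⟨hq₁, o₂, ho₂, e₂⟩ := ihq hp.2 fun a ha => hb a (.inr ha)
    refine ⟨?_, _, .inr ⟨o₁, ho₁, o₂, ho₂, rfl⟩, by simp only [Obs.size, meas, e₁, e₂]⟩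
    rintro _ (rfl | ⟨o₁, h₁, o₂, h₂, rfl⟩)
    · exact Nat.zero_le _
    · have := hp₁ _ h₁
      have := hq₁ _ h₂
      simp only [Obs.size, meas]
      omega

theorem meas_le_of_den_le {p q : Pat} {θ θ' : ℕ → Dom} (hp : p.NoWild)
    (hbp : ∀ a, p.Occurs a → (θ' a).Bounded) (hq : q.NoWild)
    (hbq : ∀ a, q.Occurs a → (θ a).Bounded) (h : p.den θ' ≤ q.den θ) :
    p.meas θ' ≤ q.meas θ := by
  obtain ⟨o, ho, e⟩ := (meas_spec hp hbp).2
  rw [← e]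
  exact (meas_spec hq hbq).1 o (h ho)

end Pat

/-! ### The dependency graph -/

section Graph

variable {F : Type*} {R : Set (Rule F)} {S : Signature F}

theorem Tm.papps_sym_inj {f g : F} {ps qs : List Pat}
    (h : (sym f).papps ps = (sym g).papps qs) : f = g ∧ ps = qs := by
  induction ps using List.reverseRecOn generalizing qs with
  | nil =>
    rcases List.eq_nil_or_concat qs with rfl | ⟨qs, q, rfl⟩
    · simpa [papps] using h
    · simp [papps] at h
  | append_singleton ps p ih =>
    rcases List.eq_nil_or_concat qs with rfl | ⟨qs, q, rfl⟩
    · simp [papps] at h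
    · simp only [papps, List.concat_eq_append, List.foldl_append, List.foldl_cons, List.foldl_nil,
        papp.injEq] at h
      obtain ⟨rfl, rfl⟩ := ih h.1
      rw [h.2]
      exact ⟨rfl, by simp⟩

theorem Tm.finite_occursIn (t : Tm F) : {x : ℕ × Tm F | x.2.OccursIn x.1 t}.Finite := by
  induction t with
  | app t u iht ihu =>
    refine ((Set.finite_singleton (0, app t u)).union (iht.union ihu)).subset ?_
    rintro ⟨d, s⟩ h
    cases h with
    | here => exact .inl rfl
    | app_left _ h => exact .inr (.inl h)
    | app_right _ h => exact .inr (.inr h)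
  | papp t p ih =>
    refine ((Set.finite_singleton (0, papp t p)).union ih).subset ?_
    rintro ⟨d, s⟩ h
    cases h with
    | here => exact .inl rfl
    | papp _ h => exact .inr h
  | lam T t ih =>
    refine ((Set.finite_singleton (0, lam T t)).union ih).subset ?_
    rintro ⟨d, s⟩ h
    cases h with
    | here => exact .inl rfl
    | lam _ h => exact .inr h
  | plam t ih =>
    refine ((Set.finite_singleton (0, plam t)).union
      (ih.image fun x => (x.1 + 1, x.2))).subset ?_
    rintro ⟨d, s⟩ h
    cases h with
    | here => exact .inl rfl
    | @plam d _ h => exact .inr ⟨(d, s), h, rfl⟩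
  | _ =>
    refine Set.Subsingleton.finite ?_
    rintro ⟨d, s⟩ h ⟨d', s'⟩ h'
    cases h
    cases h'
    rfl

/-- Needed for the pigeonhole argument on infinite chains. -/
theorem finite_depPairs (hfin : R.Finite) : (depPairs S R).Finite := by
  refine (hfin.biUnion fun r _ => ((r.rhs.finite_occursIn).preimage
    (f := fun x : ℕ × F × List Pat => (x.1, (Tm.sym x.2.1).papps x.2.2)) ?_).image
    fun x => (⟨r.head, (r.pats.take (S.nrec r.head)).map (Pat.lift x.1), x.2.1,
      x.2.2.take (S.nrec x.2.1)⟩ : DepPair F)).subset ?_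
  · rintro ⟨d, g, qs⟩ _ ⟨d', g', qs'⟩ _ h
    simp only [Prod.mk.injEq] at h
    obtain ⟨rfl, h⟩ := h
    obtain ⟨rfl, rfl⟩ := Tm.papps_sym_inj h
    rfl
  · rintro _ ⟨r, hr, d, g, qs, _, ho, rfl⟩
    exact Set.mem_biUnion hr ⟨(d, g, qs), ho, rfl⟩

/-- The call on the right-hand side of the first pair, with the first valuation, may be followed by
the second pair, with the second valuation. -/
structure Follows (S : Signature F) (R : Set (Rule F)) (m n : DepPair F × (ℕ → Dom)) : Prop where
  edge : Edge S R m.1 n.1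
  plain : ∀ p ∈ n.1.srcArgs, p.Plain
  bounded : ∀ p ∈ n.1.srcArgs, ∀ a, p.Occurs a → (n.2 a).Bounded
  den_le : List.Forall₂ (fun q p => p.den n.2 ≤ q.den m.2) m.1.tgtArgs n.1.srcArgs

theorem isCycle_of_seq {V : Type*} {E : V → V → Prop} {N : ℕ → V}
    (hN : ∀ i, E (N i) (N (i + 1))) {a k : ℕ} (h : N (a + (k + 1)) = N a) :
    IsCycle E ((List.range (k + 1)).map fun i => N (a + i)) := by
  refine ⟨N a, (List.range k).map fun i => N (a + (i + 1)), ?_, ?_⟩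
  · simp [List.range_succ_eq_map, Function.comp_def]
  · have : N a :: ((List.range k).map fun i => N (a + (i + 1))) ++ [N a] =
        (List.range (k + 2)).map fun i => N (a + i) := by
      rw [List.range_succ, List.map_append, List.range_succ_eq_map]
      simp [Function.comp_def, h]
    rw [this, List.isChain_iff_getElem]
    intro i hi
    simpa [add_assoc] using hN (a + i)

theorem transGen_of_seq {V : Type*} {E : V → V → Prop} {N : ℕ → V}
    (hN : ∀ i, E (N i) (N (i + 1))) {i j : ℕ} (h : i < j) :
    Relation.TransGen E (N i) (N j) := by
  induction j, h using Nat.le_induction with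
  | base => exact .single (hN i)
  | succ j _ ih => exact ih.tail (hN j)

/-- On an infinite chain the measure at the chosen index is eventually non-increasing, hence reaches
a minimum; a later cycle contains a strict decrease below it. -/
theorem wellFounded_follows (hfin : R.Finite)
    (hdecrease : ∀ C : Set (DepPair F), IsSCC (Edge S R) C →
      ∃ ι : F → ℕ, (∀ n ∈ C, n.AtIndex Pat.EmbEq ι) ∧
        (∀ c : List (DepPair F), IsCycle (Edge S R) c → (∀ n ∈ c, n ∈ C) →
          ∃ n ∈ c, n.AtIndex Pat.Emb ι)) :
    WellFounded fun n m => Follows S R m n := by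
  rw [wellFounded_iff_isEmpty_descending_chain]
  refine ⟨fun ⟨x, hx⟩ => ?_⟩
  have hE : ∀ i, Edge S R (x i).1 (x (i + 1)).1 := fun i => (hx i).edge
  obtain ⟨n, hn⟩ : ∃ n, ∀ i, ∃ j, i < j ∧ (x j).1 = n := by
    have := (finite_depPairs (S := S) hfin).to_subtype
    obtain ⟨n, hn⟩ := Finite.exists_infinite_fiber
      (fun i => (⟨(x i).1, (hE i).1⟩ : depPairs S R))
    rw [Set.infinite_coe_iff] at hn
    refine ⟨n, fun i => ?_⟩
    obtain ⟨j, hj, hij⟩ := hn.exists_gt i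
    exact ⟨j, hij, congrArg Subtype.val hj⟩
  obtain ⟨i₀, hi₀, hn₀⟩ := hn 0
  -- The component of the pair `n` that recurs infinitely often; every pair from `i₀` on lies
  -- between two visits to `n`.
  let C : Set (DepPair F) :=
    {m | Relation.TransGen (Edge S R) n m ∧ Relation.TransGen (Edge S R) m n}
  have hmem : ∀ i, i₀ ≤ i → (x i).1 ∈ C := by
    intro i hi
    obtain ⟨j, hij, hj⟩ := hn i
    have h₁ : Relation.TransGen (Edge S R) (x i).1 n := hj ▸ transGen_of_seq (N := fun i => (x i).1) hE hij
    rcases hi.eq_or_lt with rfl | hlt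
    · rw [hn₀] at h₁ ⊢; exact ⟨h₁, h₁⟩
    · exact ⟨hn₀ ▸ transGen_of_seq (N := fun i => (x i).1) hE hlt, h₁⟩
  obtain ⟨ι, hle, hlt⟩ := hdecrease C ⟨n, hn₀ ▸ hmem i₀ le_rfl, fun m => Iff.rfl⟩
  have : Nonempty Pat := ⟨.leaf⟩
  choose! p q hp hq hpq using fun i hi => hle _ (hmem i hi)
  have hsrc : ∀ i, i₀ ≤ i → (p i).Plain ∧ ∀ a, (p i).Occurs a → ((x i).2 a).Bounded := by
    intro i hi
    -- `Follows` constrains only its second member, so a predecessor is needed; it exists because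
    -- `i₀` is positive.
    obtain ⟨i, rfl⟩ : ∃ j, i = j + 1 := ⟨i - 1, by omega⟩
    have := List.mem_of_getElem? (hp _ hi)
    exact ⟨(hx i).plain _ this, (hx i).bounded _ this⟩
  let ρ : ℕ → ℕ := fun i => (p i).meas (x i).2
  have hρq : ∀ i, i₀ ≤ i → ρ (i + 1) ≤ (q i).meas (x i).2 := by
    intro i hi
    have hs' := hsrc (i + 1) (by omega)
    have hs := hsrc i hi
    have hden : (p (i + 1)).den (x (i + 1)).2 ≤ (q i).den (x i).2 := by
      have h₁ := hq i hi
      have h₂ := hp (i + 1) (by omega)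
      rw [← (hE i).2.2.1] at h₂
      obtain ⟨l₁, e₁⟩ := List.getElem?_eq_some_iff.1 h₁
      obtain ⟨l₂, e₂⟩ := List.getElem?_eq_some_iff.1 h₂
      have := (List.forall₂_iff_get.1 (hx i).den_le).2 _ l₁ l₂
      simp only [List.get_eq_getElem] at this
      rwa [e₁, e₂] at this
    rcases hpq i hi with e | ⟨he, _, hw⟩
    · exact Pat.meas_le_of_den_le hs'.1.noWild hs'.2 (e ▸ hs.1.noWild) (e ▸ hs.2) hden
    · exact Pat.meas_le_of_den_le hs'.1.noWild hs'.2 hw (fun a ha => hs.2 a (he.occurs ha)) hden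
  have hρ : ∀ i, i₀ ≤ i → ρ (i + 1) ≤ ρ i := by
    intro i hi
    refine (hρq i hi).trans ?_
    rcases hpq i hi with e | ⟨he, _⟩
    · rw [← e]
    · exact (he.meas_lt _).le
  obtain ⟨m, hm, hmin⟩ : ∃ m, i₀ ≤ m ∧ ∀ i, i₀ ≤ i → ρ m ≤ ρ i := by
    obtain ⟨m, hm, hmin⟩ := WellFounded.has_min (measure ρ).wf {i | i₀ ≤ i} ⟨i₀, le_refl i₀⟩
    exact ⟨m, hm, fun i hi => not_lt.1 (hmin i hi)⟩
  -- Two successive choices of visits to `n` after the minimum at `m` delimit a cycle on which the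
  -- measure can no longer drop.
  obtain ⟨a, hma, hna⟩ := hn m
  obtain ⟨b, hab, hnb⟩ := hn a
  obtain ⟨k, rfl⟩ : ∃ k, b = a + (k + 1) := ⟨b - a - 1, by omega⟩
  obtain ⟨n', hn', hemb⟩ := hlt _ (isCycle_of_seq (N := fun i => (x i).1) hE (hnb.trans hna.symm))
    (fun n' hn' => by
      obtain ⟨i, _, rfl⟩ := List.mem_map.1 hn'
      exact hmem _ (by omega))
  obtain ⟨i, _, rfl⟩ := List.mem_map.1 hn'
  have hi : i₀ ≤ a + i := by omega
  obtain ⟨p', q', hp', hq', he⟩ := hemb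
  rw [hp _ hi] at hp'
  rw [hq _ hi] at hq'
  cases hp'
  cases hq'
  have h₁ := hρq _ hi
  have h₂ := he.1.meas_lt (x (a + i)).2
  have h₃ := hmin (a + i + 1) (by omega)
  have h₄ : ρ (a + i) ≤ ρ m := by
    have : ∀ j, ρ (m + j) ≤ ρ m := fun j => by
      induction j with
      | zero => exact le_rfl
      | succ j ih => exact (hρ (m + j) (by omega)).trans ih
    have := this (a + i - m)
    rwa [Nat.add_sub_cancel' (by omega)] at this
  exact absurd (h₃.trans h₁) (not_le.2 (h₂.trans_le h₄))

/-- Induction along call chains: every call in a rule for the target symbol yields a pair that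
follows `m`, with the valuation obtained from the match. -/
theorem sym_mem_of_acc (hfin : R.Finite) (hR : ∀ r ∈ R, r.IsRewriteRule S)
    (hwt : ∀ r ∈ R, r.WellTyped S) {m : DepPair F × (ℕ → Dom)}
    (hm : Acc (fun n m => Follows S R m n) m) (hmem : m.1 ∈ depPairs S R) {η : ℕ → Dom}
    (hη : ∀ i q, m.1.tgtArgs[i]? = some q → η (S.npat m.1.tgt - 1 - i) = q.den m.2) :
    sym m.1.tgt ∈ (S.body m.1.tgt).interp R η := by
  induction hm generalizing η with
  | intro m _ ih =>
    refine sym_mem_interp_body hfin hR hwt fun r hr hhead θ hθ =>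
      (hR r hr).fully_applied.valid hR fun d g qs hl ho ζ hζ => ?_
    let n : DepPair F := ⟨r.head, (r.pats.take (S.nrec r.head)).map (Pat.lift d), g,
      qs.take (S.nrec g)⟩
    have hn : n ∈ depPairs S R := ⟨r, hr, d, g, qs, hl, ho, rfl⟩
    -- `ζ` adds values for the `d` binders above the call, which the shift of the source patterns in
    -- `depPairs` skips.
    have hlift : ∀ p : Pat, (p.lift d).den ζ = p.den θ := fun p => by
      rw [Pat.den_lift]; congr 1; exact funext hζ
    have hplain : ∀ p ∈ n.srcArgs, p.Plain := fun p hp => by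
      obtain ⟨p, hp', rfl⟩ := List.mem_map.1 hp
      exact (hθ.plain p hp').lift d
    have hden : List.Forall₂ (fun q p => p.den ζ ≤ q.den m.2) m.1.tgtArgs n.srcArgs := by
      have hlen : m.1.tgtArgs.length = S.nrec m.1.tgt := by
        obtain ⟨r', _, _, g', qs', hl', _, e⟩ := hmem
        rw [e]
        have := S.nrec_le g'
        simp; omega
      have hpl := (hR r hr).pats_length
      have hle := S.nrec_le r.head
      rw [List.forall₂_iff_get]
      refine ⟨by simp [n, hlen, ← hhead]; omega, fun i h₁ h₂ => ?_⟩
      have hik : i < S.nrec r.head := by rw [hhead]; omega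
      simp only [n, List.get_eq_getElem, List.getElem_map, List.getElem_take, hlift]
      refine (hθ.den_le i _ hik (List.getElem?_eq_getElem (by omega))).trans_eq ?_
      rw [hhead]
      exact hη i _ (List.getElem?_eq_getElem h₁)
    refine ih (n, ζ) ⟨⟨hmem, hn, hhead.symm, ?_⟩, hplain, fun p hp a ha => ?_, hden⟩ hn
      fun i q hq => ?_
    -- The edge of the graph is obtained from the inclusions of denotations.
    · refine List.forall₂_iff_get.2 ⟨hden.length_eq, fun i h₁ h₂ => ?_⟩
      exact Pat.unifiable_of_den_le (hplain _ (List.getElem_mem _))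
        ((List.forall₂_iff_get.1 hden).2 i h₁ h₂)
    · obtain ⟨p, hp', rfl⟩ := List.mem_map.1 hp
      obtain ⟨b, hb, rfl⟩ := ha.of_lift
      change (ζ (b + d)).Bounded
      rw [hζ]
      exact hθ.bounded p hp' b hb
    · have hq' : (qs.take (S.nrec g))[i]? = some q := hq
      obtain ⟨hi, rfl⟩ := List.getElem?_eq_some_iff.1 hq'
      simp only [List.length_take] at hi
      change (Ty.instList qs (S.npat g - 1 - i)).den ζ = _
      rw [← hl, Ty.instList_rev (by omega), List.getElem_take]

end Graph

end RefDP

/-! ### The termination theorem. -/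

theorem theorem1 {F : Type*} (S : RefDP.Signature F) (R : Set (RefDP.Rule F)) (hfin : R.Finite)
    (hrule : ∀ r ∈ R, r.IsRewriteRule S) (htyped : ∀ r ∈ R, r.WellTyped S)
    (hdecrease : ∀ C : Set (RefDP.DepPair F), RefDP.IsSCC (RefDP.Edge S R) C →
      ∃ ι : F → ℕ,
        (∀ n ∈ C, n.AtIndex RefDP.Pat.EmbEq ι) ∧
        (∀ c : List (RefDP.DepPair F), RefDP.IsCycle (RefDP.Edge S R) c → (∀ n ∈ c, n ∈ C) →
          ∃ n ∈ c, n.AtIndex RefDP.Pat.Emb ι))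
    (Γ : RefDP.Ctx) (t : RefDP.Tm F) (T : RefDP.Ty) (ht : RefDP.HasType S Γ t T) :
    RefDP.SN R t.erase := by
  have hwf := RefDP.wellFounded_follows hfin hdecrease
  -- An outermost symbol has no preceding pair, so its rules are unfolded once; each call found
  -- there starts a chain, accessible by `hwf`.
  have hsym : ∀ (g : F) (η : ℕ → RefDP.Dom), RefDP.ETm.sym g ∈ (S.body g).interp R η :=
    fun g η => RefDP.sym_mem_interp_body hfin hrule htyped fun r hr _ θ _ =>
      (hrule r hr).fully_applied.valid hrule fun d g' qs hl ho ζ _ => by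
        refine RefDP.sym_mem_of_acc hfin hrule htyped
          (m := (⟨r.head, (r.pats.take (S.nrec r.head)).map (RefDP.Pat.lift d), g',
            qs.take (S.nrec g')⟩, ζ)) (hwf.apply _) ⟨r, hr, d, g', qs, hl, ho, rfl⟩ fun i q hq => ?_
        have hq' : (qs.take (S.nrec g'))[i]? = some q := hq
        obtain ⟨hi, rfl⟩ := List.getElem?_eq_some_iff.1 hq'
        simp only [List.length_take] at hi
        change (RefDP.Ty.instList qs (S.npat g' - 1 - i)).den ζ = _
        rw [← hl, RefDP.Ty.instList_rev (by omega), List.getElem_take]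
  have hcand := fun U => RefDP.isCand_interp (R := R) hrule U fun _ => RefDP.Dom.bot
  -- Any valuation would do; the identity substitution is admissible because variables are
  -- computable at every type.
  have := RefDP.valid_of_sym hrule hsym t (fun _ => RefDP.Dom.bot) Γ T RefDP.ETm.var ht
    fun x U _ => (hcand U).var_mem x
  rw [RefDP.ETm.subst_var] at this
  exact (hcand T).sn _ this
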